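/- Let $D$ be the closed unit disc, $\mathbb T$ the unit circle with normalized Lebesgue measure, $\langle f,g\rangle=\int_{\mathbb T} f\overline g$, and let $H^2$ be the Hardy space of the circle. Let $\mathrm{Rat}(D)$ be the algebra (under the usual multiplication) of rational functions without poles in $D$. Fix $\varphi\in H^2$ and write $\varphi(w)$, $|w|<1$, for its analytic extension to the open disc. For $r\in\mathrm{Rat}(D)$ let $T_{\overline\varphi}r\in\mathrm{Rat}(D)$ be the rational function with $(T_{\overline\varphi}r)(w)=\langle \overline\varphi\, r,\frac1{1-\overline w z}\rangle$ for $|w|<1$. For $r,s\in\mathrm{Rat}(D)$ put $$r\times s=z\,r\,T_{\overline\varphi}(s)+z\,s\,T_{\overline\varphi}(r)-T_{\overline\varphi}(z r s),\qquad r\circ s=r+s-r\times s,$$ and write $\mathrm{Rat}^\times(D)$ for $\mathrm{Rat}(D)$ with the multiplication $\times$. An element $t$ is called circle invertible if $t\circ t'=0$ for some $t'\in\mathrm{Rat}(D)$. Let $\gamma_+(r)=z\,T_{\overline\varphi}(r)\in\mathrm{Rat}(D)$. For $|w|<1$ let $$\Gamma_+(w;r)=w\Big\langle r,\frac{\varphi}{1-\overline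 w z}\Big\rangle,\qquad \Gamma_-(w;r)=\Big\langle \frac{\varphi}{w-z},r\Big\rangle .$$ Both are analytic in $|w|<1$, and $\Gamma_+(\cdot\,;r)$ extends analytically to a neighbourhood of $D$, as the rational function $\gamma_+(r)$. Let $\mathrm{ord}_w(f)\in\{0,1,2,\dots,\infty\}$ denote the order of the zero at $w$ of a function $f$ analytic near $w$. (i) An element $t\in\mathrm{Rat}^\times(D)$ is circle invertible if and only if $1-\gamma_+(t)$ is invertible in $\mathrm{Rat}(D)$ and $\Gamma_-(a;t)\neq1$ for every $|a|<1$ with $\varphi(a)=0$. (ii) Let $r,s\in\mathrm{Rat}^\times(D)$. There is a circle invertible $t\in\mathrm{Rat}^\times(D)$ with $r\circ t=s$ if and only if both of the following hold: (a) for each $|w|\le1$, $\mathrm{ord}_w(1-\Gamma_+(w;r))=\mathrm{ord}_w(1-\Gamma_+(w;s))$; (b) for each $|w|<1$, $\min(\mathrm{ord}_w(\varphi),\mathrm{ord}_w(1-\Gamma_-(w;r)))=\min(\mathrm{ord}_w(\varphi),\mathrm{ord}_w(1-\Gamma_-(w;s)))$. -/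

import Mathlib

open Polynomial MeasureTheory ComplexConjugate

noncomputable section

namespace HardyCircle

/-- The coordinate function `z` of the unit circle, the circle being parametrized by `ℝ / ℤ`. -/
def zc (x : UnitAddCircle) : ℂ := fourier 1 x

/-- The pairing `⟨f, g⟩ = ∫ f \bar g dm` of functions on the circle, where `m` is the normalized
Lebesgue measure. -/
def pairing (f g : UnitAddCircle → ℂ) : ℂ :=
  ∫ x, f x * conj (g x) ∂AddCircle.haarAddCircle

/-- The kernel `k_w = 1 / (1 - \bar w z)`, as a function on the circle. -/
def kernel (w : ℂ) (x : UnitAddCircle) : ℂ := 1 / (1 - conj w * zc x)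

/-- `P_+ f`, as a function on the open unit disc: `(P_+ f)(w) = ⟨f, k_w⟩` for `|w| < 1`. -/
def projPlus (f : UnitAddCircle → ℂ) (w : ℂ) : ℂ := pairing f (kernel w)

/-- The Hardy space `H²` of the circle: the functions in `L²` of the circle whose Fourier
coefficients of negative index vanish. -/
def Hardy : Submodule ℂ (Lp ℂ 2 (AddCircle.haarAddCircle (T := (1 : ℝ)))) where
  carrier := {f | ∀ n : ℤ, n < 0 → fourierCoeff f n = 0}
  add_mem' := by
    intro f g hf hg n hn
    simp only [Set.mem_ofPred_eq, ← fourierBasis_repr] at *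
    simp [hf n hn, hg n hn]
  zero_mem' := by
    intro n _
    rw [← fourierBasis_repr]
    simp
  smul_mem' := by
    intro c f hf n hn
    simp only [Set.mem_ofPred_eq, ← fourierBasis_repr] at *
    simp [hf n hn]

/-- The boundary function of `φ ∈ H²`, defined almost everywhere on the circle. -/
def bdry (φ : Hardy) : UnitAddCircle → ℂ :=
  ((φ : Lp ℂ 2 (AddCircle.haarAddCircle (T := (1 : ℝ)))) : UnitAddCircle → ℂ)

/-- The value at `w` (with `|w| < 1`) of the analytic extension of `φ ∈ H²` to the open disc. -/
def hardyEval (φ : Hardy) (w : ℂ) : ℂ := projPlus (bdry φ) w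

/-- `Rat(D)`: the rational functions without poles in the closed unit disc. -/
def RatD : Subalgebra ℂ (RatFunc ℂ) where
  carrier := {f | ∀ w : ℂ, ‖w‖ ≤ 1 → f.denom.eval w ≠ 0}
  mul_mem' := by
    intro f g hf hg w hw h
    have := eval_eq_zero_of_dvd_of_eval_eq_zero (RatFunc.denom_mul_dvd f g) h
    rw [eval_mul] at this
    exact mul_ne_zero (hf w hw) (hg w hw) this
  add_mem' := by
    intro f g hf hg w hw h
    have := eval_eq_zero_of_dvd_of_eval_eq_zero (RatFunc.denom_add_dvd f g) h
    rw [eval_mul] at this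
    exact mul_ne_zero (hf w hw) (hg w hw) this
  algebraMap_mem' := by
    intro c w _
    rw [RatFunc.algebraMap_eq_C, RatFunc.denom_C]
    simp

/-- The value of `r ∈ Rat(D)` at `w`. -/
def ratEval (r : RatD) (w : ℂ) : ℂ := RatFunc.eval (RingHom.id ℂ) w (r : RatFunc ℂ)

/-- A polynomial, as an element of `Rat(D)`. -/
def RatD.ofPoly (p : ℂ[X]) : RatD :=
  ⟨algebraMap ℂ[X] (RatFunc ℂ) p, by
    intro w _
    rw [RatFunc.denom_algebraMap]
    simp⟩

/-- The identity function `z`, as an element of `Rat(D)`. -/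
def RatD.z : RatD := RatD.ofPoly X

theorem ratEval_add (r s : RatD) {w : ℂ} (hw : ‖w‖ ≤ 1) :
    ratEval (r + s) w = ratEval r w + ratEval s w :=
  RatFunc.eval_add (f := RingHom.id ℂ) w (r.2 w hw) (s.2 w hw)

theorem ratEval_mul (r s : RatD) {w : ℂ} (hw : ‖w‖ ≤ 1) :
    ratEval (r * s) w = ratEval r w * ratEval s w :=
  RatFunc.eval_mul (f := RingHom.id ℂ) w (r.2 w hw) (s.2 w hw)

theorem ratEval_ofPoly (p : ℂ[X]) (w : ℂ) : ratEval (RatD.ofPoly p) w = p.eval w := by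
  simp [ratEval, RatD.ofPoly, RatFunc.eval_algebraMap, eval₂_eq_eval_map]

theorem norm_zc (x : UnitAddCircle) : ‖zc x‖ = 1 := by
  exact Circle.norm_coe _

theorem zc_mul_conj (x : UnitAddCircle) : zc x * conj (zc x) = 1 := by
  rw [Complex.mul_conj, Complex.normSq_eq_norm_sq, norm_zc]
  simp

theorem continuous_zc : Continuous zc := (fourier 1).continuous

theorem conj_kernel (w : ℂ) (x : UnitAddCircle) :
    conj (kernel w x) = 1 / (1 - w * conj (zc x)) := by
  simp [kernel]

theorem kernel_denom_ne {w : ℂ} (hw : ‖w‖ < 1) (x : UnitAddCircle) :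
    1 - w * conj (zc x) ≠ 0 := by
  intro h
  have h1 : ‖w * conj (zc x)‖ = 1 := by
    rw [← sub_eq_zero.mp h]
    simp
  rw [norm_mul, RCLike.norm_conj, norm_zc] at h1
  linarith

theorem continuous_conj_kernel {w : ℂ} (hw : ‖w‖ < 1) :
    Continuous fun x => conj (kernel w x) := by
  simp only [conj_kernel]
  exact continuous_const.div
    (continuous_const.sub (continuous_const.mul (Complex.continuous_conj.comp continuous_zc)))
    (kernel_denom_ne hw)

theorem continuous_ratEval (r : RatD) : Continuous fun x => ratEval r (zc x) := by
  unfold ratEval RatFunc.eval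
  simp only [eval₂_id]
  exact ((Polynomial.continuous _).comp continuous_zc).div
    ((Polynomial.continuous _).comp continuous_zc) fun x => r.2 _ (norm_zc x).le

theorem integrable_conj_mul (φ : Hardy) {b : UnitAddCircle → ℂ} (hb : Continuous b) :
    Integrable (fun x => conj (bdry φ x) * b x)
      (AddCircle.haarAddCircle (T := (1 : ℝ))) := by
  have h1 : Integrable (fun x => conj (bdry φ x))
      (AddCircle.haarAddCircle (T := (1 : ℝ))) := by
    have h0 := (Lp.memLp (φ : Lp ℂ 2 (AddCircle.haarAddCircle (T := (1 : ℝ))))).integrable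
      (by norm_num)
    exact (Complex.conjLIE.toContinuousLinearEquiv.toContinuousLinearMap).integrable_comp h0
  obtain ⟨C, hC⟩ := isCompact_univ.exists_bound_of_continuousOn hb.continuousOn
  exact h1.mul_bdd (c := C) hb.aestronglyMeasurable (Filter.Eventually.of_forall fun x => hC x trivial)

/-- The property that `g = T_{\bar φ} h`. -/
def IsToeplitz (φ : Hardy) (h g : RatD) : Prop :=
  ∀ w : ℂ, ‖w‖ < 1 →
    ratEval g w = projPlus (fun x => conj (bdry φ x) * ratEval h (zc x)) w

theorem integrable_aux (φ : Hardy) (h : RatD) {w : ℂ} (hw : ‖w‖ < 1) :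
    Integrable (fun x => conj (bdry φ x) * ratEval h (zc x) * conj (kernel w x))
      (AddCircle.haarAddCircle (T := (1 : ℝ))) := by
  simp only [mul_assoc]
  exact integrable_conj_mul φ ((continuous_ratEval h).mul (continuous_conj_kernel hw))

theorem IsToeplitz.add {φ : Hardy} {h h' g g' : RatD} (H : IsToeplitz φ h g)
    (H' : IsToeplitz φ h' g') : IsToeplitz φ (h + h') (g + g') := by
  intro w hw
  rw [ratEval_add _ _ hw.le, H w hw, H' w hw]
  unfold projPlus pairing
  rw [← integral_add (integrable_aux φ h hw) (integrable_aux φ h' hw)]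
  congr 1
  ext x
  beta_reduce
  rw [ratEval_add _ _ (norm_zc x).le]
  ring

theorem IsToeplitz.const_mul {φ : Hardy} {h g : RatD} (c : ℂ) (H : IsToeplitz φ h g) :
    IsToeplitz φ (RatD.ofPoly (C c) * h) (RatD.ofPoly (C c) * g) := by
  intro w hw
  rw [ratEval_mul _ _ hw.le, H w hw, ratEval_ofPoly, eval_C]
  unfold projPlus pairing
  rw [← integral_const_mul]
  congr 1
  ext x
  beta_reduce
  rw [ratEval_mul _ _ (norm_zc x).le, ratEval_ofPoly, eval_C]
  ring

/-- The value of `P_+ (\bar φ z h)` at `w`, compared with its value at `0`. -/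
theorem projPlus_z_mul (φ : Hardy) (h : RatD) {w : ℂ} (hw : ‖w‖ < 1) :
    projPlus (fun x => conj (bdry φ x) * ratEval (RatD.z * h) (zc x)) w =
      w * projPlus (fun x => conj (bdry φ x) * ratEval h (zc x)) w +
        projPlus (fun x => conj (bdry φ x) * ratEval (RatD.z * h) (zc x)) 0 := by
  unfold projPlus pairing
  rw [← integral_const_mul, ← integral_add ((integrable_aux φ h hw).const_mul w)
    (integrable_aux φ (RatD.z * h) (by simp))]
  congr 1
  ext x
  beta_reduce
  rw [ratEval_mul _ _ (norm_zc x).le, RatD.z, ratEval_ofPoly, eval_X, conj_kernel, conj_kernel]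
  have h1 := kernel_denom_ne hw x
  have h2 := zc_mul_conj x
  field_simp
  linear_combination ((conj (bdry φ x)) * ratEval h (zc x) * w) * h2

theorem IsToeplitz.z_mul {φ : Hardy} {h g : RatD} (H : IsToeplitz φ h g) :
    ∃ g', IsToeplitz φ (RatD.z * h) g' := by
  refine ⟨RatD.z * g + RatD.ofPoly (C (projPlus
    (fun x => conj (bdry φ x) * ratEval (RatD.z * h) (zc x)) 0)), fun w hw => ?_⟩
  rw [projPlus_z_mul φ h hw, ratEval_add _ _ hw.le, ratEval_mul _ _ hw.le, H w hw,
    ratEval_ofPoly, eval_C, RatD.z, ratEval_ofPoly, eval_X]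

theorem integral_conj_mul_pow (φ : Hardy) (n : ℕ) (hn : n ≠ 0) :
    ∫ x, conj (bdry φ x) * conj (zc x) ^ n
      ∂(AddCircle.haarAddCircle (T := (1 : ℝ))) = 0 := by
  have h := φ.2 (-n) (by omega)
  unfold fourierCoeff at h
  have h' := congrArg conj h
  rw [← integral_conj, map_zero] at h'
  rw [← h']
  congr 1
  ext x
  have : (fourier (- -(n : ℤ)) x : ℂ) = zc x ^ n := by
    rw [neg_neg, zc, fourier_apply, fourier_apply, one_zsmul, ← Circle.coe_pow,
      ← AddCircle.toCircle_nsmul, natCast_zsmul]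
  rw [this]
  simp [mul_comm, bdry]

theorem isToeplitz_one (φ : Hardy) :
    IsToeplitz φ 1 (RatD.ofPoly (C (∫ x, conj (bdry φ x)
      ∂(AddCircle.haarAddCircle (T := (1 : ℝ)))))) := by
  intro w hw
  rw [ratEval_ofPoly, eval_C]
  unfold projPlus pairing
  have hone : ∀ x, ratEval (1 : RatD) (zc x) = 1 := fun x => by simp [ratEval]
  simp only [hone, mul_one]
  have key : ∀ n : ℕ, ∫ x, conj (bdry φ x) * conj (kernel w x)
      ∂(AddCircle.haarAddCircle (T := (1 : ℝ))) -
      ∫ x, conj (bdry φ x) ∂(AddCircle.haarAddCircle (T := (1 : ℝ))) =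
      w ^ (n + 1) * ∫ x, conj (bdry φ x) * (conj (zc x) ^ (n + 1) * conj (kernel w x))
      ∂(AddCircle.haarAddCircle (T := (1 : ℝ))) := by
    have hcz : Continuous fun x => conj (zc x) := Complex.continuous_conj.comp continuous_zc
    have hI : ∀ n : ℕ, Integrable (fun x => conj (bdry φ x) *
        (conj (zc x) ^ n * conj (kernel w x))) (AddCircle.haarAddCircle (T := (1 : ℝ))) :=
      fun n => integrable_conj_mul φ ((hcz.pow n).mul (continuous_conj_kernel hw))
    have hJ : ∀ n : ℕ, Integrable (fun x => conj (bdry φ x) *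
        conj (zc x) ^ n) (AddCircle.haarAddCircle (T := (1 : ℝ))) :=
      fun n => integrable_conj_mul φ (hcz.pow n)
    have step : ∀ n : ℕ, ∫ x, conj (bdry φ x) * (conj (zc x) ^ n * conj (kernel w x))
        ∂(AddCircle.haarAddCircle (T := (1 : ℝ))) =
        ∫ x, conj (bdry φ x) * conj (zc x) ^ n
          ∂(AddCircle.haarAddCircle (T := (1 : ℝ))) +
        w * ∫ x, conj (bdry φ x) * (conj (zc x) ^ (n + 1) * conj (kernel w x))
          ∂(AddCircle.haarAddCircle (T := (1 : ℝ))) := by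
      intro n
      rw [← integral_const_mul, ← integral_add (hJ n) ((hI (n + 1)).const_mul w)]
      congr 1
      ext x
      have h1 := kernel_denom_ne hw x
      rw [conj_kernel]
      field_simp
      ring
    intro n
    induction n with
    | zero =>
      have := step 0
      simp only [pow_zero, one_mul, mul_one] at this
      rw [this]
      ring
    | succ n ih =>
      rw [ih, step (n + 1), integral_conj_mul_pow φ (n + 1) (by omega)]
      ring
  obtain ⟨K, hK⟩ := isCompact_univ.exists_bound_of_continuousOn
    (continuous_conj_kernel hw).continuousOn
  have hφ : Integrable (fun x => ‖bdry φ x‖)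
      (AddCircle.haarAddCircle (T := (1 : ℝ))) :=
    ((Lp.memLp (φ : Lp ℂ 2 (AddCircle.haarAddCircle (T := (1 : ℝ))))).integrable
      (by norm_num)).norm
  set M : ℝ := ∫ x, ‖bdry φ x‖ * K ∂(AddCircle.haarAddCircle (T := (1 : ℝ)))
  have bound : ∀ n : ℕ, ‖∫ x, conj (bdry φ x) * (conj (zc x) ^ (n + 1) *
      conj (kernel w x)) ∂(AddCircle.haarAddCircle (T := (1 : ℝ)))‖ ≤ M := by
    intro n
    refine norm_integral_le_of_norm_le (hφ.mul_const K) (Filter.Eventually.of_forall fun x => ?_)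
    have := hK x trivial
    rw [norm_mul, norm_mul, norm_pow, RCLike.norm_conj, RCLike.norm_conj (zc x), norm_zc,
      one_pow, one_mul]
    gcongr
  have hlim : Filter.Tendsto (fun n : ℕ => ‖w‖ ^ (n + 1) * M) Filter.atTop (nhds (0 * M)) :=
    (((tendsto_pow_atTop_nhds_zero_of_lt_one (norm_nonneg w) hw).comp
      (Filter.tendsto_add_atTop_nat 1)).mul_const M)
  rw [zero_mul] at hlim
  have hle := ge_of_tendsto' hlim fun n => by
    show ‖∫ x, conj (bdry φ x) * conj (kernel w x)
      ∂(AddCircle.haarAddCircle (T := (1 : ℝ))) -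
      ∫ x, conj (bdry φ x) ∂(AddCircle.haarAddCircle (T := (1 : ℝ)))‖ ≤ _
    rw [key n, norm_mul, norm_pow]
    exact mul_le_mul_of_nonneg_left (bound n) (by positivity)
  exact (sub_eq_zero.mp (norm_le_zero_iff.mp hle)).symm

theorem exists_isToeplitz_ofPoly (φ : Hardy) (p : ℂ[X]) :
    ∃ g, IsToeplitz φ (RatD.ofPoly p) g := by
  have hm : ∀ p q : ℂ[X], RatD.ofPoly (p * q) = RatD.ofPoly p * RatD.ofPoly q := fun p q =>
    Subtype.ext (map_mul (algebraMap ℂ[X] (RatFunc ℂ)) p q)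
  have ha : ∀ p q : ℂ[X], RatD.ofPoly (p + q) = RatD.ofPoly p + RatD.ofPoly q := fun p q =>
    Subtype.ext (map_add (algebraMap ℂ[X] (RatFunc ℂ)) p q)
  have h1 : RatD.ofPoly 1 = 1 := Subtype.ext (map_one (algebraMap ℂ[X] (RatFunc ℂ)))
  induction p using Polynomial.induction_on with
  | C a =>
    have := (isToeplitz_one φ).const_mul a
    rw [mul_one] at this
    exact ⟨_, this⟩
  | add p q hp hq =>
    obtain ⟨g, hg⟩ := hp
    obtain ⟨g', hg'⟩ := hq
    rw [ha]
    exact ⟨_, hg.add hg'⟩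
  | monomial n a hn =>
    obtain ⟨g, hg⟩ := hn
    have : RatD.ofPoly (C a * X ^ (n + 1)) = RatD.z * RatD.ofPoly (C a * X ^ n) := by
      rw [RatD.z, ← hm]
      congr 1
      ring
    rw [this]
    exact hg.z_mul

/-- `(z - β)⁻¹ ∈ Rat(D)` for `|β| > 1`. -/
theorem exists_inv_linear {β : ℂ} (hβ : 1 < ‖β‖) : ∃ j : RatD, RatD.ofPoly (X - C β) * j = 1 := by
  have hne : (algebraMap ℂ[X] (RatFunc ℂ)) (X - C β) ≠ 0 :=
    (map_ne_zero_iff _ (IsFractionRing.injective ℂ[X] (RatFunc ℂ))).mpr (X_sub_C_ne_zero β)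
  refine ⟨⟨((algebraMap ℂ[X] (RatFunc ℂ)) (X - C β))⁻¹, fun w hw h => ?_⟩,
    Subtype.ext (mul_inv_cancel₀ hne)⟩
  have hd : RatFunc.denom ((algebraMap ℂ[X] (RatFunc ℂ)) (X - C β))⁻¹ ∣ X - C β := by
    have := RatFunc.denom_div_dvd (1 : ℂ[X]) (X - C β)
    rwa [map_one, one_div] at this
  have h0 := eval_eq_zero_of_dvd_of_eval_eq_zero hd h
  rw [eval_sub, eval_X, eval_C, sub_eq_zero] at h0
  rw [h0] at hw
  linarith

theorem IsToeplitz.of_linear_mul {φ : Hardy} {h g : RatD} {β : ℂ} (hβ : 1 < ‖β‖)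
    (H : IsToeplitz φ (RatD.ofPoly (X - C β) * h) g) : ∃ g', IsToeplitz φ h g' := by
  obtain ⟨j, hj⟩ := exists_inv_linear hβ
  set c : ℂ := projPlus (fun x => conj (bdry φ x) * ratEval (RatD.z * h) (zc x)) 0 with hc
  refine ⟨j * (g + RatD.ofPoly (C (-c))), fun w hw => ?_⟩
  have hj' : (w - β) * ratEval j w = 1 := by
    have := congrArg (fun r => ratEval r w) hj
    simp only [ratEval_mul _ _ hw.le, ratEval_ofPoly] at this
    simpa [ratEval] using this
  have hlin : projPlus (fun x => conj (bdry φ x) *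
      ratEval (RatD.ofPoly (X - C β) * h) (zc x)) w =
      projPlus (fun x => conj (bdry φ x) * ratEval (RatD.z * h) (zc x)) w -
      β * projPlus (fun x => conj (bdry φ x) * ratEval h (zc x)) w := by
    unfold projPlus pairing
    rw [← integral_const_mul, ← integral_sub (integrable_aux φ (RatD.z * h) hw)
      ((integrable_aux φ h hw).const_mul β)]
    congr 1
    ext x
    beta_reduce
    rw [ratEval_mul _ _ (norm_zc x).le, ratEval_mul _ _ (norm_zc x).le, RatD.z,
      ratEval_ofPoly, ratEval_ofPoly]
    simp only [eval_sub, eval_X, eval_C]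
    ring
  rw [projPlus_z_mul φ h hw, ← hc] at hlin
  rw [ratEval_mul _ _ hw.le, ratEval_add _ _ hw.le, H w hw, ratEval_ofPoly, eval_C, hlin]
  linear_combination
    (projPlus (fun x => conj (bdry φ x) * ratEval h (zc x)) w) * hj'

/-- `T_{\bar φ}` maps `Rat(D)` into itself. -/
theorem exists_isToeplitz (φ : Hardy) (h : RatD) : ∃ g, IsToeplitz φ h g := by
  have hm : ∀ p q : ℂ[X], RatD.ofPoly (p * q) = RatD.ofPoly p * RatD.ofPoly q := fun p q =>
    Subtype.ext (map_mul (algebraMap ℂ[X] (RatFunc ℂ)) p q)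
  suffices main : ∀ (n : ℕ) (q p : ℂ[X]) (h : RatD), q.natDegree = n →
      (∀ w : ℂ, ‖w‖ ≤ 1 → q.eval w ≠ 0) → RatD.ofPoly q * h = RatD.ofPoly p →
      ∃ g, IsToeplitz φ h g by
    refine main _ (h : RatFunc ℂ).denom (h : RatFunc ℂ).num h rfl h.2 (Subtype.ext ?_)
    change algebraMap ℂ[X] (RatFunc ℂ) (h : RatFunc ℂ).denom * (h : RatFunc ℂ) =
      algebraMap ℂ[X] (RatFunc ℂ) (h : RatFunc ℂ).num
    have hd : algebraMap ℂ[X] (RatFunc ℂ) (h : RatFunc ℂ).denom ≠ 0 :=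
      (map_ne_zero_iff _ (IsFractionRing.injective ℂ[X] (RatFunc ℂ))).mpr
        (RatFunc.denom_ne_zero _)
    conv_lhs => rw [← RatFunc.num_div_denom (h : RatFunc ℂ), RatFunc.num_div_denom]
    nth_rewrite 2 [← RatFunc.num_div_denom (h : RatFunc ℂ)]
    field_simp
  intro n
  induction n with
  | zero =>
    intro q p h hq hq0 hqh
    obtain ⟨c, rfl⟩ : ∃ c, q = C c := ⟨_, eq_C_of_natDegree_eq_zero hq⟩
    have hc : c ≠ 0 := by simpa using hq0 0 (by simp)
    have : h = RatD.ofPoly (C c⁻¹ * p) := by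
      rw [hm, ← hqh, ← mul_assoc, ← hm, ← C_mul, inv_mul_cancel₀ hc]
      have h1 : RatD.ofPoly (C 1) = 1 := Subtype.ext (by simp [RatD.ofPoly])
      rw [h1, one_mul]
    rw [this]
    exact exists_isToeplitz_ofPoly φ _
  | succ n ih =>
    intro q p h hq hq0 hqh
    obtain ⟨β, hβ⟩ := IsAlgClosed.exists_root q (by
      intro h0
      rw [natDegree_eq_of_degree_eq_some (n := 0) h0] at hq
      omega)
    have hβ1 : 1 < ‖β‖ := by
      by_contra hcon
      exact hq0 β (not_lt.mp hcon) hβ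
    obtain ⟨q', rfl⟩ := dvd_iff_isRoot.mpr hβ
    have hq'0 : q' ≠ 0 := by
      rintro rfl
      simp at hq
    have hdeg : q'.natDegree = n := by
      rw [natDegree_mul (X_sub_C_ne_zero β) hq'0, natDegree_X_sub_C] at hq
      omega
    obtain ⟨g, hg⟩ := ih q' p (RatD.ofPoly (X - C β) * h) hdeg
      (fun w hw h0 => hq0 w hw (by rw [eval_mul, h0, mul_zero]))
      (by rw [← hqh, hm]; ring)
    exact hg.of_linear_mul hβ1

/-- The co-analytic Toeplitz operator `T_{\bar φ}` on `Rat(D)`: `T_{\bar φ} r` is the element of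
`Rat(D)` that is equal to `P_+ (\bar φ r)` on the open unit disc. -/
def toeplitz (φ : Hardy) (r : RatD) : RatD := Classical.choose (exists_isToeplitz φ r)

theorem toeplitz_val (φ : Hardy) (r : RatD) (w : ℂ) (hw : ‖w‖ < 1) :
    ratEval (toeplitz φ r) w = projPlus (fun x => conj (bdry φ x) * ratEval r (zc x)) w :=
  Classical.choose_spec (exists_isToeplitz φ r) w hw

/-- The twisted multiplication
`r × s = z r T_{\bar φ}(s) + z s T_{\bar φ}(r) - T_{\bar φ}(z r s)` on `Rat(D)`. -/
def times (φ : Hardy) (r s : RatD) : RatD :=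
  RatD.z * r * toeplitz φ s + RatD.z * s * toeplitz φ r - toeplitz φ (RatD.z * r * s)

/-- The circle composition `r ∘ s = r + s - r × s`. -/
def circ (φ : Hardy) (r s : RatD) : RatD := r + s - times φ r s

/-- `t` is circle invertible: it has an inverse for `∘`, whose neutral element is `0`. -/
def CircleInvertible (φ : Hardy) (t : RatD) : Prop := ∃ s : RatD, circ φ t s = 0

/-- `γ₊(r) = z T_{\bar φ}(r)`. -/
def gammaPlus (φ : Hardy) (r : RatD) : RatD := RatD.z * toeplitz φ r

/-- `Γ₊(w; r) = w ⟨r, φ / (1 - \bar w z)⟩` for `|w| < 1`, given by its integral. -/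
def GammaPlusInt (φ : Hardy) (w : ℂ) (r : RatD) : ℂ :=
  w * pairing (fun x => ratEval r (zc x)) (fun x => bdry φ x / (1 - conj w * zc x))

/-- `Γ₊(w; r)` for `w` in a neighbourhood of the closed unit disc: the rational function that
extends the integral `GammaPlusInt` (see `GammaPlus_eq_int`). -/
def GammaPlus (φ : Hardy) (w : ℂ) (r : RatD) : ℂ := ratEval (gammaPlus φ r) w

theorem GammaPlus_eq_int (φ : Hardy) (w : ℂ) (hw : ‖w‖ < 1) (r : RatD) :
    GammaPlus φ w r = GammaPlusInt φ w r := by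
  rw [GammaPlus, gammaPlus, ratEval_mul _ _ hw.le, toeplitz_val φ r w hw, RatD.z,
    ratEval_ofPoly, eval_X, GammaPlusInt, projPlus, pairing, pairing]
  congr 2
  ext x
  rw [conj_kernel]
  simp only [map_div₀, map_sub, map_one, map_mul, Complex.conj_conj]
  ring

/-- `Γ₋(w; r) = ⟨φ / (w - z), r⟩` for `|w| < 1`. -/
def GammaMinus (φ : Hardy) (w : ℂ) (r : RatD) : ℂ :=
  pairing (fun x => bdry φ x / (w - zc x)) (fun x => ratEval r (zc x))

/-- For each `|w| ≤ 1`, `ord_w(1 - Γ₊(·; r)) = ord_w(1 - Γ₊(·; s))`. -/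
def ConditionA (φ : Hardy) (r s : RatD) : Prop :=
  ∀ w : ℂ, ‖w‖ ≤ 1 →
    analyticOrderAt (fun u => 1 - GammaPlus φ u r) w =
      analyticOrderAt (fun u => 1 - GammaPlus φ u s) w

/-- For each `|w| < 1`,
`min(ord_w φ, ord_w(1 - Γ₋(·; r))) = min(ord_w φ, ord_w(1 - Γ₋(·; s)))`. -/
def ConditionB (φ : Hardy) (r s : RatD) : Prop :=
  ∀ w : ℂ, ‖w‖ < 1 →
    min (analyticOrderAt (hardyEval φ) w) (analyticOrderAt (fun u => 1 - GammaMinus φ u r) w) =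
      min (analyticOrderAt (hardyEval φ) w) (analyticOrderAt (fun u => 1 - GammaMinus φ u s) w)

end HardyCircle

end

/-! Write `r = p / q` with `deg p ≤ N`, `deg q ≤ N + 1`, and let `P`, `Q` be the conjugate
reflections of `p`, `q`. On the circle `conj r = z P / Q`, and `Q` has degree exactly `N + 1` with
all roots in the open disc. By residues, `Γ₋ = (F - φ P) / Q`, where `F / Q` is the principal part
of `φ P / Q`; outside the disc the same `F / Q` is the reflection of `Γ₊`
(`IsFrac.exists_principalPart`). With `B = Q - F`, `1 - Γ₋ = (B + φ P) / Q` and `1 - Γ₊` is the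
reflection of `B / Q`; since `deg F < deg Q`, the polynomial `B` is unique.

The symbol of `r ∘ s` is the product `B B'` (`IsSymbol.circ`). Hence `1 - γ₊` is multiplicative, and
`1 - Γ₋` is multiplicative modulo `φ`. This gives the necessity in (i) and (ii).

For the converse in (ii), condition (a) gives symbols `G B₁` of `r` and `G B₂` of `s`, where `G` has
no zeros in the open disc and the `Bᵢ` have zeros only there. A solution `t` must have symbol
quotient `B₂ Q₁ / (B₁ Q₂)`. So take `Q = B₁ Q₂` as its reflected denominator; the unknown is its
reflected numerator `P`. Analyticity of `1 - Γ₋(·; t)` and the equation `r ∘ t = s` become two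
congruences modulo `Q`, namely `φ P ≡ -B₂ Q₁` and `(1 - Γ₋(·; r)) P ≡ P₂ B₁ - P₁ B₂`. Condition (b)
makes them compatible (`exists_solution_of_congruences`). The freedom left in `P` makes `t` circle
invertible.

The converse in (i) is the case `s = 0` of this construction. -/

namespace HardyCircle

/-! ### Reflection of polynomials in the unit circle -/

section ConjReflect

/-- The polynomial `w ↦ w ^ N * conj (p (1 / conj w))`, for `p` of degree at most `N`. -/
noncomputable def conjReflect (N : ℕ) (p : ℂ[X]) : ℂ[X] :=
  reflect N (p.map (starRingEnd ℂ))

theorem conjReflect_conjReflect (N : ℕ) (p : ℂ[X]) : conjReflect N (conjReflect N p) = p := by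
  unfold conjReflect
  rw [← reflect_map, reflect_reflect, Polynomial.map_map]
  ext n
  simp

theorem natDegree_conjReflect_le {N : ℕ} {p : ℂ[X]} (hp : p.natDegree ≤ N) :
    (conjReflect N p).natDegree ≤ N := by
  refine natDegree_reflect_le.trans (max_le le_rfl ?_)
  rwa [natDegree_map]

theorem conjReflect_add (N : ℕ) (p q : ℂ[X]) :
    conjReflect N (p + q) = conjReflect N p + conjReflect N q := by
  simp [conjReflect, reflect_add]

theorem conjReflect_sub (N : ℕ) (p q : ℂ[X]) :
    conjReflect N (p - q) = conjReflect N p - conjReflect N q := by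
  simp [conjReflect, reflect_sub]

theorem conjReflect_mul {N M : ℕ} {p q : ℂ[X]} (hp : p.natDegree ≤ N) (hq : q.natDegree ≤ M) :
    conjReflect (N + M) (p * q) = conjReflect N p * conjReflect M q := by
  unfold conjReflect
  rw [Polynomial.map_mul]
  exact reflect_mul _ _ (by rwa [natDegree_map]) (by rwa [natDegree_map])

theorem conjReflect_one_X : conjReflect 1 X = 1 := by
  simp [conjReflect]

theorem conjReflect_succ {N : ℕ} {p : ℂ[X]} (hp : p.natDegree ≤ N) :
    conjReflect (N + 1) p = X * conjReflect N p := by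
  have := conjReflect_mul (N := N) (M := 1) hp (q := 1) (by simp)
  rw [mul_one] at this
  rw [this, mul_comm]
  simp [conjReflect]

theorem conjReflect_succ_X_mul {N : ℕ} {p : ℂ[X]} (hp : p.natDegree ≤ N) :
    conjReflect (N + 1) (X * p) = conjReflect N p := by
  have := conjReflect_mul (N := 1) (M := N) (p := X) (by simp) hp
  rw [add_comm, this, conjReflect_one_X, one_mul]

theorem coeff_conjReflect_self (N : ℕ) (p : ℂ[X]) :
    (conjReflect N p).coeff N = conj (p.eval 0) := by
  simp [conjReflect, coeff_reflect, revAt_le, coeff_zero_eq_eval_zero]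

theorem eval_zero_conjReflect (N : ℕ) (p : ℂ[X]) :
    (conjReflect N p).eval 0 = conj (p.coeff N) := by
  simp [← coeff_zero_eq_eval_zero, conjReflect, coeff_reflect, revAt_le]

theorem eval_conjReflect {N : ℕ} {p : ℂ[X]} (hp : p.natDegree ≤ N) {w : ℂ} (hw : w ≠ 0) :
    (conjReflect N p).eval w = w ^ N * conj (p.eval (conj w)⁻¹) := by
  have hi : w⁻¹ ≠ 0 := inv_ne_zero hw
  let _ := invertibleOfNonzero hi
  have h := eval₂_reflect_mul_pow (RingHom.id ℂ) w⁻¹ N (p.map (starRingEnd ℂ))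
    (by rwa [natDegree_map])
  rw [invOf_eq_inv, inv_inv, eval₂_id, eval₂_id, inv_pow] at h
  have h2 : (p.map (starRingEnd ℂ)).eval w⁻¹ = conj (p.eval (conj w)⁻¹) := by
    have := eval_map_apply (f := starRingEnd ℂ) (p := p) ((conj w)⁻¹)
    simpa using this
  rw [← h2, ← h]
  unfold conjReflect
  field_simp

/-- The inversion `w ↦ 1 / conj w` carries the exterior of the open disc into the closed disc. -/
theorem conjReflect_eval_ne_zero {N : ℕ} {q : ℂ[X]} (hN : q.natDegree ≤ N)
    (hq : ∀ w : ℂ, ‖w‖ ≤ 1 → q.eval w ≠ 0) {x : ℂ} (hx : 1 ≤ ‖x‖) :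
    (conjReflect N q).eval x ≠ 0 := by
  have hx0 : x ≠ 0 := norm_pos_iff.mp (by linarith)
  rw [eval_conjReflect hN hx0]
  refine mul_ne_zero (pow_ne_zero _ hx0) ?_
  rw [Ne, map_eq_zero]
  refine hq _ ?_
  rw [norm_inv, RCLike.norm_conj]
  exact inv_le_one_of_one_le₀ hx

/-- The same inversion in the other direction. At the origin, where it is undefined, the value is
the conjugate of the top coefficient; this is the role of `hc`. -/
theorem conjReflect_eval_ne_zero_of_coeff {N : ℕ} {q : ℂ[X]} (hN : q.natDegree ≤ N)
    (hc : q.coeff N ≠ 0) (hq : ∀ w : ℂ, 1 ≤ ‖w‖ → q.eval w ≠ 0) {x : ℂ} (hx : ‖x‖ ≤ 1) :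
    (conjReflect N q).eval x ≠ 0 := by
  rcases eq_or_ne x 0 with rfl | hx0
  · rw [eval_zero_conjReflect]
    simpa using hc
  rw [eval_conjReflect hN hx0]
  refine mul_ne_zero (pow_ne_zero _ hx0) ?_
  rw [Ne, map_eq_zero]
  refine hq _ ?_
  rw [norm_inv, RCLike.norm_conj]
  exact (one_le_inv₀ (norm_pos_iff.mpr hx0)).mpr hx

theorem natDegree_conjReflect {N : ℕ} {q : ℂ[X]} (hN : q.natDegree ≤ N) (hq : q.eval 0 ≠ 0) :
    (conjReflect N q).natDegree = N := by
  refine le_antisymm (natDegree_conjReflect_le hN) (le_natDegree_of_ne_zero ?_)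
  rw [coeff_conjReflect_self]
  simpa using hq

end ConjReflect

/-! ### Polynomials and analytic functions on the disc -/

section Disc

/-- The open unit disc. -/
abbrev unitDisc : Set ℂ := Metric.ball 0 1

theorem mem_unitDisc {w : ℂ} : w ∈ unitDisc ↔ ‖w‖ < 1 := mem_ball_zero_iff

theorem differentiableOn_eval (p : ℂ[X]) (s : Set ℂ) : DifferentiableOn ℂ (fun w => p.eval w) s :=
  p.differentiable.differentiableOn

theorem analyticAt_of_differentiableOn {g : ℂ → ℂ} (hg : DifferentiableOn ℂ g unitDisc) {a : ℂ}
    (ha : ‖a‖ < 1) : AnalyticAt ℂ g a :=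
  hg.analyticAt (Metric.isOpen_ball.mem_nhds (mem_unitDisc.mpr ha))

/-- Two continuous functions that agree on the disc away from the zeros of a nonzero polynomial
agree on the disc. -/
theorem eq_of_eval_mul_eq {Q : ℂ[X]} (hQ : Q ≠ 0) {f g : ℂ → ℂ} (hf : ContinuousOn f unitDisc)
    (hg : ContinuousOn g unitDisc) (h : ∀ w, ‖w‖ < 1 → Q.eval w * f w = Q.eval w * g w)
    {w : ℂ} (hw : ‖w‖ < 1) : f w = g w := by
  have hU : unitDisc ∈ nhds w := Metric.isOpen_ball.mem_nhds (mem_unitDisc.mpr hw)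
  have hfw := (hf.continuousAt hU).tendsto.mono_left (nhdsWithin_le_nhds (s := {w}ᶜ))
  have hgw := (hg.continuousAt hU).tendsto.mono_left (nhdsWithin_le_nhds (s := {w}ᶜ))
  refine tendsto_nhds_unique_of_eventuallyEq hfw hgw ?_
  have hfin : {x | Q.eval x = 0}.Finite := by
    simpa [IsRoot] using Q.finite_setOfPred_isRoot hQ
  have h1 : ∀ᶠ x in nhdsWithin w {w}ᶜ, Q.eval x ≠ 0 := by
    have : ({x | Q.eval x = 0} \ {w})ᶜ ∈ nhds w :=
      (hfin.sdiff).isClosed.isOpen_compl.mem_nhds (by simp)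
    filter_upwards [nhdsWithin_le_nhds this, self_mem_nhdsWithin] with x hx hx' hx0
    exact hx ⟨hx0, hx'⟩
  filter_upwards [h1, nhdsWithin_le_nhds hU] with x hx hxU
  exact mul_left_cancel₀ hx (h x (mem_unitDisc.mp hxU))

/-- Induction on the roots of a nonzero complex polynomial. -/
theorem induction_on_roots {motive : ℂ[X] → Prop} {Q : ℂ[X]} {U : Set ℂ} (hQ : Q ≠ 0)
    (hU : ∀ a, Q.eval a = 0 → a ∈ U) (const : ∀ c : ℂ, c ≠ 0 → motive (C c))
    (mul : ∀ a ∈ U, ∀ q : ℂ[X], q ≠ 0 → motive q → motive ((X - C a) * q)) : motive Q := by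
  induction hn : Q.natDegree generalizing Q with
  | zero =>
    obtain ⟨c, rfl⟩ : ∃ c, Q = C c := ⟨_, eq_C_of_natDegree_eq_zero hn⟩
    exact const c (by rintro rfl; simp at hQ)
  | succ n ih =>
    obtain ⟨a, ha⟩ := IsAlgClosed.exists_root Q (by
      intro h0
      rw [natDegree_eq_of_degree_eq_some (n := 0) h0] at hn
      omega)
    obtain ⟨q, rfl⟩ := dvd_iff_isRoot.mpr ha
    have hq : q ≠ 0 := right_ne_zero_of_mul hQ
    refine mul a (hU a ha) q hq (ih hq (fun b hb => hU b (by simp [hb])) ?_)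
    rw [natDegree_mul (X_sub_C_ne_zero a) hq, natDegree_X_sub_C] at hn
    omega

/-- Divisibility among functions on the disc implies divisibility among polynomials, if the roots
of the divisor are in the disc. -/
theorem dvd_of_eval_eq_mul {Q p : ℂ[X]} (hQ : Q ≠ 0) (hroot : ∀ a, Q.eval a = 0 → ‖a‖ < 1)
    {g : ℂ → ℂ} (hg : ContinuousOn g unitDisc)
    (h : ∀ w, ‖w‖ < 1 → p.eval w = Q.eval w * g w) : Q ∣ p := by
  revert p
  refine induction_on_roots (U := {a | ‖a‖ < 1})
    (motive := fun Q => ∀ {p : ℂ[X]}, (∀ w, ‖w‖ < 1 → p.eval w = Q.eval w * g w) → Q ∣ p)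
    hQ hroot ?_ ?_
  · intro c hc p _
    exact (isUnit_C.mpr hc.isUnit).dvd
  · intro a ha q hq ih p h
    have hpa : p.eval a = 0 := by rw [h a ha]; simp
    obtain ⟨p', rfl⟩ := dvd_iff_isRoot.mpr hpa
    refine mul_dvd_mul_left _ (ih fun w hw => ?_)
    -- Cancelling `w - a` is immediate for `w ≠ a`; continuity covers `w = a`.
    refine eq_of_eval_mul_eq (X_sub_C_ne_zero a) (differentiableOn_eval p' _).continuousOn
      ((differentiableOn_eval q _).continuousOn.mul hg) (fun w hw => ?_) hw
    have := h w hw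
    rw [eval_mul, eval_mul] at this
    rw [this, mul_assoc]
    rfl

/-- Division with remainder of an analytic function on the disc by a polynomial. -/
theorem exists_polynomial_remainder {W : ℂ[X]} (hW : W ≠ 0) (hroot : ∀ a, W.eval a = 0 → ‖a‖ < 1)
    {g : ℂ → ℂ} (hg : DifferentiableOn ℂ g unitDisc) :
    ∃ (f : ℂ[X]) (k : ℂ → ℂ), DifferentiableOn ℂ k unitDisc ∧
      ∀ w, ‖w‖ < 1 → g w = f.eval w + W.eval w * k w := by
  revert g
  refine induction_on_roots (U := {a | ‖a‖ < 1})
    (motive := fun W => ∀ {g : ℂ → ℂ}, DifferentiableOn ℂ g unitDisc →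
      ∃ (f : ℂ[X]) (k : ℂ → ℂ), DifferentiableOn ℂ k unitDisc ∧
        ∀ w, ‖w‖ < 1 → g w = f.eval w + W.eval w * k w) hW hroot ?_ ?_
  · intro c hc g hg
    refine ⟨0, fun w => c⁻¹ * g w, hg.const_mul _, fun w _ => ?_⟩
    simp [hc]
  · intro a ha q hq ih g hg
    have hd : DifferentiableOn ℂ (dslope g a) unitDisc :=
      (Complex.differentiableOn_dslope
        (Metric.isOpen_ball.mem_nhds (mem_unitDisc.mpr ha))).mpr hg
    -- With `g = g(a) + (z - a) g₁`, division of `g₁` by `q` gives division of `g` by `(z - a) q`.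
    obtain ⟨f, k, hk, hfk⟩ := ih hd
    refine ⟨C (g a) + (X - C a) * f, k, hk, fun w hw => ?_⟩
    have h1 := sub_smul_dslope g a w
    rw [hfk w hw, smul_eq_mul] at h1
    simp only [eval_add, eval_mul, eval_C, eval_sub, eval_X]
    linear_combination -h1

/-- Divisibility of a polynomial by a power of a linear factor, in terms of analytic orders. -/
theorem pow_dvd_iff_le_analyticOrderAt (p : ℂ[X]) (a : ℂ) (e : ℕ) :
    (X - C a) ^ e ∣ p ↔ (e : ℕ∞) ≤ analyticOrderAt (fun w => p.eval w) a := by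
  constructor
  · rintro ⟨q, rfl⟩
    rw [natCast_le_analyticOrderAt (AnalyticAt.aeval_polynomial analyticAt_id _)]
    refine ⟨fun w => q.eval w, AnalyticAt.aeval_polynomial analyticAt_id q,
      Filter.Eventually.of_forall fun w => by simp⟩
  · induction e generalizing p with
    | zero => simp
    | succ e ih =>
      intro h
      have h0 : p.eval a = 0 :=
        apply_eq_zero_of_analyticOrderAt_ne_zero (f := fun w => p.eval w)
          (by rintro h0; rw [h0] at h; simp at h)
      obtain ⟨q, rfl⟩ := dvd_iff_isRoot.mpr h0
      rw [pow_succ']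
      refine mul_dvd_mul_left _ (ih q ?_)
      have hm : analyticOrderAt (fun w => ((X - C a) * q).eval w) a =
          1 + analyticOrderAt (fun w => q.eval w) a := by
        have : (fun w => ((X - C a) * q).eval w) = (fun w => w - a) * fun w => q.eval w := by
          ext w; simp
        rw [this, analyticOrderAt_mul (by fun_prop)
          (AnalyticAt.aeval_polynomial analyticAt_id q)]
        congr 1
        exact analyticOrderAt_id_sub_const_self
      rw [hm, Nat.cast_add, Nat.cast_one, add_comm] at h
      exact (ENat.add_le_add_iff_left (by simp)).mp h

/-- Over `ℂ`, divisibility can be tested on powers of linear factors. -/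
theorem dvd_of_forall_pow_dvd {h p : ℂ[X]} (hh : h ≠ 0)
    (H : ∀ (a : ℂ) (e : ℕ), (X - C a) ^ e ∣ h → (X - C a) ^ e ∣ p) : h ∣ p := by
  rcases eq_or_ne p 0 with rfl | hp
  · simp
  rw [IsAlgClosed.dvd_iff_roots_le_roots hh hp, Multiset.le_iff_count]
  intro a
  rw [count_roots, count_roots, le_rootMultiplicity_iff hp]
  exact H a _ (pow_rootMultiplicity_dvd h a)

/-- A polynomial is the product of a factor with roots in the closed disc, determined by the
multiplicities of these roots, and a factor without roots there. -/
theorem exists_common_factor {b₁ b₂ : ℂ[X]} (h₁ : b₁ ≠ 0) (h₂ : b₂ ≠ 0) {U : Set ℂ}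
    (h : ∀ w ∈ U, ∀ e : ℕ, (X - C w) ^ e ∣ b₁ ↔ (X - C w) ^ e ∣ b₂) :
    ∃ g c₁ c₂ : ℂ[X], b₁ = g * c₁ ∧ b₂ = g * c₂ ∧ (∀ w, g.eval w = 0 → w ∈ U) ∧
      (∀ w ∈ U, c₁.eval w ≠ 0) ∧ ∀ w ∈ U, c₂.eval w ≠ 0 := by
  classical
  have key : ∀ b : ℂ[X], b ≠ 0 → ∃ c, b =
      ((b.roots.filter (· ∈ U)).map fun a => X - C a).prod * c ∧ ∀ w ∈ U, c.eval w ≠ 0 := by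
    intro b hb
    obtain ⟨c, hc⟩ : ((b.roots.filter (· ∈ U)).map fun a => X - C a).prod ∣ b :=
      (Multiset.prod_dvd_prod_of_le (Multiset.map_le_map (Multiset.filter_le _ _))).trans
        b.prod_multiset_X_sub_C_dvd
    refine ⟨c, hc, fun w hw hw0 => ?_⟩
    have hr := congrArg (fun p => (roots p).count w) hc
    have hne := hb
    rw [hc] at hne
    simp only [roots_mul hne, roots_multiset_prod_X_sub_C, Multiset.count_add,
      Multiset.count_filter_of_pos hw] at hr
    have : 0 < c.roots.count w :=
      Multiset.count_pos.mpr ((mem_roots (right_ne_zero_of_mul hne)).mpr hw0)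
    omega
  obtain ⟨c₁, hc₁, hc₁'⟩ := key b₁ h₁
  obtain ⟨c₂, hc₂, hc₂'⟩ := key b₂ h₂
  have heq : b₁.roots.filter (· ∈ U) = b₂.roots.filter (· ∈ U) := by
    ext a
    by_cases ha : a ∈ U
    · rw [Multiset.count_filter_of_pos ha, Multiset.count_filter_of_pos ha, count_roots,
        count_roots]
      refine le_antisymm ?_ ?_
      · rw [le_rootMultiplicity_iff h₂, ← h a ha]
        exact pow_rootMultiplicity_dvd b₁ a
      · rw [le_rootMultiplicity_iff h₁, h a ha]
        exact pow_rootMultiplicity_dvd b₂ a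
    · rw [Multiset.count_filter_of_neg ha, Multiset.count_filter_of_neg ha]
  rw [← heq] at hc₂
  refine ⟨_, c₁, c₂, hc₁, hc₂, fun w hw => ?_, hc₁', hc₂'⟩
  have : w ∈ (((b₁.roots.filter (· ∈ U)).map fun a => X - C a).prod).roots :=
    (mem_roots (Multiset.prod_ne_zero (by
      simp only [Multiset.mem_map, not_exists, not_and]
      exact fun a _ => X_sub_C_ne_zero a))).mpr hw
  rw [roots_multiset_prod_X_sub_C, Multiset.mem_filter] at this
  exact this.2

end Disc

/-! ### Fractions in `Rat(D)` and their boundary values -/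

section RationalFunctions

theorem RatD.ofPoly_mul (p q : ℂ[X]) : RatD.ofPoly (p * q) = RatD.ofPoly p * RatD.ofPoly q :=
  Subtype.ext (map_mul (algebraMap ℂ[X] (RatFunc ℂ)) p q)

theorem RatD.ofPoly_add (p q : ℂ[X]) : RatD.ofPoly (p + q) = RatD.ofPoly p + RatD.ofPoly q :=
  Subtype.ext (map_add (algebraMap ℂ[X] (RatFunc ℂ)) p q)

theorem RatD.ofPoly_sub (p q : ℂ[X]) : RatD.ofPoly (p - q) = RatD.ofPoly p - RatD.ofPoly q :=
  Subtype.ext (map_sub (algebraMap ℂ[X] (RatFunc ℂ)) p q)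

theorem RatD.ofPoly_zero : RatD.ofPoly 0 = 0 :=
  Subtype.ext (map_zero (algebraMap ℂ[X] (RatFunc ℂ)))

theorem RatD.ofPoly_injective : Function.Injective RatD.ofPoly := fun _ _ h =>
  IsFractionRing.injective ℂ[X] (RatFunc ℂ) (congrArg Subtype.val h)

theorem RatD.ofPoly_ne_zero {p : ℂ[X]} (hp : p ≠ 0) : RatD.ofPoly p ≠ 0 := fun h =>
  hp (RatD.ofPoly_injective (h.trans RatD.ofPoly_zero.symm))

theorem ratEval_one (w : ℂ) : ratEval 1 w = 1 := by simp [ratEval]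

theorem ratEval_zero (w : ℂ) : ratEval 0 w = 0 := by simp [ratEval]

theorem ratEval_sub (r s : RatD) {w : ℂ} (hw : ‖w‖ ≤ 1) :
    ratEval (r - s) w = ratEval r w - ratEval s w := by
  have := ratEval_add (r - s) s hw
  rw [sub_add_cancel] at this
  rw [this, add_sub_cancel_right]

/-- The denominator of an element of `Rat(D)` times the element is its numerator. -/
theorem denom_mul_eq_num (r : RatD) :
    RatD.ofPoly (r : RatFunc ℂ).denom * r = RatD.ofPoly (r : RatFunc ℂ).num := by
  refine Subtype.ext ?_
  change algebraMap ℂ[X] (RatFunc ℂ) (r : RatFunc ℂ).denom * (r : RatFunc ℂ) =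
    algebraMap ℂ[X] (RatFunc ℂ) (r : RatFunc ℂ).num
  have hd : algebraMap ℂ[X] (RatFunc ℂ) (r : RatFunc ℂ).denom ≠ 0 :=
    (map_ne_zero_iff _ (IsFractionRing.injective ℂ[X] (RatFunc ℂ))).mpr
      (RatFunc.denom_ne_zero _)
  have h := RatFunc.num_div_denom (r : RatFunc ℂ)
  rw [div_eq_iff hd] at h
  rw [h, mul_comm]

/-- An element of `Rat(D)` is determined by its values in the punctured open disc. -/
theorem ratD_ext {r s : RatD} (h : ∀ w, w ≠ 0 → ‖w‖ < 1 → ratEval r w = ratEval s w) :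
    r = s := by
  rw [← sub_eq_zero]
  set t := r - s with ht
  have hz : ∀ w, w ≠ 0 → ‖w‖ < 1 → (t : RatFunc ℂ).num.eval w = 0 := by
    intro w hw0 hw
    have h1 := congrArg (fun r => ratEval r w) (denom_mul_eq_num t)
    simp only [ratEval_mul _ _ hw.le, ratEval_ofPoly] at h1
    rw [← h1, ht, ratEval_sub _ _ hw.le, h w hw0 hw, sub_self, mul_zero]
  have hnum : (t : RatFunc ℂ).num = 0 := by
    by_contra hne
    have hall : ∀ w, ‖w‖ < 1 → (t : RatFunc ℂ).num.eval w = 0 := fun w hw =>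
      eq_of_eval_mul_eq (X_ne_zero (R := ℂ)) (f := fun w => (t : RatFunc ℂ).num.eval w)
        (g := fun _ => 0) (differentiableOn_eval _ _).continuousOn continuousOn_const (by
          intro w hw
          rcases eq_or_ne w 0 with rfl | hw0
          · simp
          · simp [hz w hw0 hw]) hw
    have hinf : {w : ℂ | (t : RatFunc ℂ).num.eval w = 0}.Infinite := by
      refine Set.Infinite.mono (s := unitDisc) (fun w hw => hall w (mem_unitDisc.mp hw)) ?_
      exact infinite_of_mem_nhds 0 (Metric.ball_mem_nhds 0 one_pos)
    exact hinf (by simpa [IsRoot] using (t : RatFunc ℂ).num.finite_setOfPred_isRoot hne)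
  have h1 := denom_mul_eq_num t
  rw [hnum, RatD.ofPoly_zero] at h1
  exact (mul_eq_zero.mp h1).resolve_left (RatD.ofPoly_ne_zero (RatFunc.denom_ne_zero _))

/-- A polynomial without zeros in the closed disc is invertible in `Rat(D)`. -/
theorem isUnit_ofPoly {q : ℂ[X]} (hq : ∀ w : ℂ, ‖w‖ ≤ 1 → q.eval w ≠ 0) :
    IsUnit (RatD.ofPoly q) := by
  have hq0 : q ≠ 0 := by
    rintro rfl
    simpa using hq 0 (by simp)
  have hne : (algebraMap ℂ[X] (RatFunc ℂ)) q ≠ 0 :=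
    (map_ne_zero_iff _ (IsFractionRing.injective ℂ[X] (RatFunc ℂ))).mpr hq0
  refine IsUnit.of_mul_eq_one ⟨((algebraMap ℂ[X] (RatFunc ℂ)) q)⁻¹, fun w hw h => ?_⟩
    (Subtype.ext (mul_inv_cancel₀ hne))
  have hd : RatFunc.denom ((algebraMap ℂ[X] (RatFunc ℂ)) q)⁻¹ ∣ q := by
    have := RatFunc.denom_div_dvd (1 : ℂ[X]) q
    rwa [map_one, one_div] at this
  exact hq w hw (eval_eq_zero_of_dvd_of_eval_eq_zero hd h)

theorem isUnit_iff_of_mul_eq {ρ : RatD} {q b : ℂ[X]} (hq : ∀ w : ℂ, ‖w‖ ≤ 1 → q.eval w ≠ 0)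
    (h : RatD.ofPoly q * ρ = RatD.ofPoly b) :
    IsUnit ρ ↔ ∀ w : ℂ, ‖w‖ ≤ 1 → b.eval w ≠ 0 := by
  constructor
  · intro hu w hw hb
    obtain ⟨j, hj⟩ := hu.exists_right_inv
    have h1 := congrArg (fun r => ratEval r w) hj
    have h2 := congrArg (fun r => ratEval r w) h
    simp only [ratEval_mul _ _ hw, ratEval_ofPoly, ratEval_one] at h1 h2
    rw [hb, mul_eq_zero] at h2
    rw [h2.resolve_left (hq w hw)] at h1
    simp at h1
  · intro hb
    have := isUnit_ofPoly hb
    rw [← h] at this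
    exact isUnit_of_mul_isUnit_right this

/-- Near a point of the closed disc, an element of `Rat(D)` is given by any of its fractions. -/
theorem eventually_ratEval_eq {ρ : RatD} {q b : ℂ[X]} (h : RatD.ofPoly q * ρ = RatD.ofPoly b)
    {w : ℂ} (hw : ‖w‖ ≤ 1) :
    ∀ᶠ u in nhds w, q.eval u * ratEval ρ u = b.eval u := by
  have hd : ∀ᶠ u in nhds w, (ρ : RatFunc ℂ).denom.eval u ≠ 0 :=
    (Polynomial.continuous _).continuousAt.eventually_ne (ρ.2 w hw)
  have hpoly : q * (ρ : RatFunc ℂ).num = b * (ρ : RatFunc ℂ).denom := by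
    apply RatD.ofPoly_injective
    rw [RatD.ofPoly_mul, RatD.ofPoly_mul, ← h, ← denom_mul_eq_num]
    ring
  filter_upwards [hd] with u hu
  have h1 := congrArg (eval u) hpoly
  rw [eval_mul, eval_mul] at h1
  unfold ratEval RatFunc.eval
  simp only [eval₂_id]
  field_simp
  rw [h1, mul_comm]

theorem analyticAt_eval (p : ℂ[X]) (w : ℂ) : AnalyticAt ℂ (fun u => p.eval u) w :=
  AnalyticAt.aeval_polynomial analyticAt_id p

/-- The order of `1 - γ` at a point of the closed disc, for `γ ∈ Rat(D)`. -/
theorem analyticOrderAt_one_sub_ratEval {γ : RatD} {q b : ℂ[X]} {w : ℂ} (hw : ‖w‖ ≤ 1)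
    (hq : q.eval w ≠ 0) (h : RatD.ofPoly q * (1 - γ) = RatD.ofPoly b) :
    analyticOrderAt (fun u => 1 - ratEval γ u) w = analyticOrderAt (fun u => b.eval u) w := by
  have h' : RatD.ofPoly q * γ = RatD.ofPoly (q - b) := by
    rw [RatD.ofPoly_sub, ← h]
    ring
  have hq' : ∀ᶠ u in nhds w, q.eval u ≠ 0 :=
    (Polynomial.continuous _).continuousAt.eventually_ne hq
  have hcongr : (fun u => 1 - ratEval γ u) =ᶠ[nhds w]
      (fun u => b.eval u) * fun u => (q.eval u)⁻¹ := by
    filter_upwards [eventually_ratEval_eq h' hw, hq'] with u hu hu0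
    rw [eval_sub] at hu
    simp only [Pi.mul_apply]
    field_simp
    linear_combination -hu
  have hinv : AnalyticAt ℂ (fun u => (q.eval u)⁻¹) w := (analyticAt_eval q w).inv hq
  rw [analyticOrderAt_congr hcongr, analyticOrderAt_mul (analyticAt_eval b w) hinv,
    hinv.analyticOrderAt_eq_zero.mpr (inv_ne_zero hq), add_zero]

/-- `r = p / q` in `Rat(D)`, with `q` without zeros in the closed disc, and with bounds on the
degrees. -/
structure IsFrac (r : RatD) (p q : ℂ[X]) (N : ℕ) : Prop where
  natDegree_num : p.natDegree ≤ N
  natDegree_den : q.natDegree ≤ N + 1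
  den_ne : ∀ w : ℂ, ‖w‖ ≤ 1 → q.eval w ≠ 0
  eq : RatD.ofPoly q * r = RatD.ofPoly p

theorem exists_isFrac (r : RatD) : ∃ p q N, IsFrac r p q N :=
  ⟨(r : RatFunc ℂ).num, (r : RatFunc ℂ).denom,
    max (r : RatFunc ℂ).num.natDegree (r : RatFunc ℂ).denom.natDegree,
    le_max_left _ _, (le_max_right _ _).trans (Nat.le_succ _), r.2, denom_mul_eq_num r⟩

namespace IsFrac

variable {r s : RatD} {p q p' q' : ℂ[X]} {N N' : ℕ}

theorem eval (h : IsFrac r p q N) {w : ℂ} (hw : ‖w‖ ≤ 1) :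
    q.eval w * ratEval r w = p.eval w := by
  rw [← ratEval_ofPoly, ← ratEval_mul _ _ hw, h.eq, ratEval_ofPoly]

theorem den_ne_zero (h : IsFrac r p q N) : q ≠ 0 := by
  rintro rfl
  simpa using h.den_ne 0 (by simp)

/-- Since `q` does not vanish at `0`, the degree is exact for any admissible `N`. Enlarging `N`
multiplies both reflections by a power of `X`, so fractions need not be reduced nor `N` minimal. -/
theorem natDegree_reflect_den (h : IsFrac r p q N) :
    (conjReflect (N + 1) q).natDegree = N + 1 :=
  natDegree_conjReflect h.natDegree_den (h.den_ne 0 (by simp))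

theorem reflect_den_ne_zero (h : IsFrac r p q N) : conjReflect (N + 1) q ≠ 0 := by
  intro h0
  have := h.natDegree_reflect_den
  rw [h0] at this
  simp at this

theorem reflect_den_root (h : IsFrac r p q N) {a : ℂ}
    (ha : (conjReflect (N + 1) q).eval a = 0) : ‖a‖ < 1 := by
  by_contra hcon
  exact conjReflect_eval_ne_zero h.natDegree_den h.den_ne (not_lt.mp hcon) ha

theorem natDegree_reflect_num (h : IsFrac r p q N) : (conjReflect N p).natDegree ≤ N :=
  natDegree_conjReflect_le h.natDegree_num

/-- The fraction on the unit circle, after conjugation. -/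
theorem conj_eval_zc (h : IsFrac r p q N) (x : UnitAddCircle) :
    (conjReflect (N + 1) q).eval (zc x) * conj (ratEval r (zc x)) =
      zc x * (conjReflect N p).eval (zc x) := by
  have hz : zc x ≠ 0 := norm_pos_iff.mp (by rw [norm_zc]; norm_num)
  have hzi : (conj (zc x))⁻¹ = zc x := inv_eq_of_mul_eq_one_left (zc_mul_conj x)
  rw [eval_conjReflect h.natDegree_den hz, eval_conjReflect h.natDegree_num hz, hzi,
    ← h.eval (norm_zc x).le, map_mul]
  ring

theorem zmul (h : IsFrac r p q N) (h' : IsFrac s p' q' N') :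
    IsFrac (RatD.z * r * s) (X * (p * p')) (q * q') (N + N' + 1) where
  natDegree_num := by
    refine natDegree_mul_le.trans ?_
    have := natDegree_mul_le (p := p) (q := p')
    have := h.natDegree_num
    have := h'.natDegree_num
    rw [natDegree_X]
    omega
  natDegree_den := by
    refine natDegree_mul_le.trans ?_
    have := h.natDegree_den
    have := h'.natDegree_den
    omega
  den_ne w hw := by
    rw [eval_mul]
    exact mul_ne_zero (h.den_ne w hw) (h'.den_ne w hw)
  eq := by
    rw [RatD.ofPoly_mul, RatD.ofPoly_mul, RatD.ofPoly_mul, ← h.eq, ← h'.eq, RatD.z]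
    ring

theorem reflect_den_mul (h : IsFrac r p q N) (h' : IsFrac s p' q' N') :
    conjReflect (N + N' + 1 + 1) (q * q') = conjReflect (N + 1) q * conjReflect (N' + 1) q' := by
  rw [← conjReflect_mul h.natDegree_den h'.natDegree_den]
  congr 1
  ring

theorem reflect_num_zmul (h : IsFrac r p q N) (h' : IsFrac s p' q' N') :
    conjReflect (N + N' + 1) (X * (p * p')) = conjReflect N p * conjReflect N' p' := by
  rw [← conjReflect_mul h.natDegree_num h'.natDegree_num, conjReflect_succ_X_mul]
  refine natDegree_mul_le.trans ?_
  have := h.natDegree_num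
  have := h'.natDegree_num
  omega

end IsFrac

/-- Strictly proper fractions with poles in the open disc come from `Rat(D)`. -/
theorem exists_isFrac_conjReflect {P Q : ℂ[X]} {N : ℕ} (hP : P.natDegree ≤ N)
    (hQ : Q.natDegree = N + 1) (hroot : ∀ a, Q.eval a = 0 → ‖a‖ < 1) :
    ∃ t : RatD, IsFrac t (conjReflect N P) (conjReflect (N + 1) Q) N := by
  have hne : ∀ w : ℂ, ‖w‖ ≤ 1 → (conjReflect (N + 1) Q).eval w ≠ 0 := fun w hw =>
    conjReflect_eval_ne_zero_of_coeff hQ.le (by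
      rw [← hQ]
      exact leadingCoeff_ne_zero.mpr (by rintro rfl; simp at hQ))
      (fun x hx h0 => absurd (hroot x h0) (not_lt.mpr hx)) hw
  obtain ⟨j, hj⟩ := (isUnit_ofPoly hne).exists_right_inv
  refine ⟨j * RatD.ofPoly (conjReflect N P), natDegree_conjReflect_le hP,
    natDegree_conjReflect_le hQ.le, hne, ?_⟩
  rw [← mul_assoc, hj, one_mul]

end RationalFunctions

/-! ### Cauchy integrals against `φ` and the principal part -/

section Integrals

theorem integrable_bdry (φ : Hardy) : Integrable (bdry φ) AddCircle.haarAddCircle :=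
  (Lp.memLp (φ : Lp ℂ 2 (AddCircle.haarAddCircle (T := (1 : ℝ))))).integrable (by norm_num)

theorem integrable_mul_continuous {f b : UnitAddCircle → ℂ}
    (hf : Integrable f AddCircle.haarAddCircle) (hb : Continuous b) :
    Integrable (fun x => f x * b x) AddCircle.haarAddCircle := by
  obtain ⟨C, hC⟩ := isCompact_univ.exists_bound_of_continuousOn hb.continuousOn
  exact hf.mul_bdd (c := C) hb.aestronglyMeasurable
    (Filter.Eventually.of_forall fun x => hC x trivial)

theorem integrable_bdry_mul (φ : Hardy) {b : UnitAddCircle → ℂ} (hb : Continuous b) :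
    Integrable (fun x => bdry φ x * b x) AddCircle.haarAddCircle :=
  integrable_mul_continuous (integrable_bdry φ) hb

theorem continuous_kernel {w : ℂ} (hw : ‖w‖ < 1) : Continuous (kernel w) := by
  have := Complex.continuous_conj.comp (continuous_conj_kernel hw)
  simpa [Function.comp_def] using this

theorem continuous_eval_zc (p : ℂ[X]) : Continuous fun x => p.eval (zc x) :=
  p.continuous.comp continuous_zc

theorem conj_kernel_spec {w : ℂ} (hw : ‖w‖ < 1) (x : UnitAddCircle) :
    conj (kernel w x) * (zc x - w) = zc x := by
  rw [conj_kernel]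
  have h1 := kernel_denom_ne hw x
  have h2 := zc_mul_conj x
  field_simp
  linear_combination w * h2

theorem kernel_spec {w : ℂ} (hw : ‖w‖ < 1) (x : UnitAddCircle) :
    kernel w x * (1 - conj w * zc x) = 1 := by
  have h1 := kernel_denom_ne hw x
  have h2 : 1 - conj w * zc x ≠ 0 := by
    intro h
    apply h1
    have := congrArg conj h
    simpa using this
  rw [kernel, one_div, inv_mul_cancel₀ h2]

theorem integral_bdry_mul_pow_succ (φ : Hardy) (n : ℕ) :
    ∫ x, bdry φ x * zc x ^ (n + 1) ∂AddCircle.haarAddCircle = 0 := by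
  have h := congrArg conj (integral_conj_mul_pow φ (n + 1) (by omega))
  rw [← integral_conj, map_zero] at h
  simpa using h

/-- The conjugate of the fact that `T_{\bar φ} 1` is constant. -/
theorem integral_bdry_mul_kernel (φ : Hardy) {w : ℂ} (hw : ‖w‖ < 1) :
    ∫ x, bdry φ x * kernel w x ∂AddCircle.haarAddCircle =
      ∫ x, bdry φ x ∂AddCircle.haarAddCircle := by
  have h := congrArg conj (isToeplitz_one φ w hw)
  rw [ratEval_ofPoly, eval_C, projPlus, pairing, ← integral_conj, ← integral_conj] at h
  simpa [ratEval_one] using h.symm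

/-- The integrand is analytic and vanishes at `0`, so its mean is zero. Formally, `conj w · z k_w =
k_w - 1` lowers the power of `z`; division by `conj w` leaves `w = 0` as a separate case. -/
theorem integral_bdry_mul_pow_succ_mul_kernel (φ : Hardy) {w : ℂ} (hw : ‖w‖ < 1) (n : ℕ) :
    ∫ x, bdry φ x * (zc x ^ (n + 1) * kernel w x) ∂AddCircle.haarAddCircle = 0 := by
  have hk := continuous_kernel hw
  have hz := continuous_zc
  have step : ∀ n : ℕ,
      conj w * ∫ x, bdry φ x * (zc x ^ (n + 1) * kernel w x) ∂AddCircle.haarAddCircle =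
        ∫ x, bdry φ x * (zc x ^ n * kernel w x) ∂AddCircle.haarAddCircle -
        ∫ x, bdry φ x * zc x ^ n ∂AddCircle.haarAddCircle := by
    intro n
    rw [← integral_const_mul, ← integral_sub (integrable_bdry_mul φ (by fun_prop))
      (integrable_bdry_mul φ (by fun_prop))]
    congr 1
    ext x
    linear_combination -(bdry φ x * zc x ^ n) * kernel_spec hw x
  rcases eq_or_ne w 0 with rfl | hw0
  · simpa [kernel] using integral_bdry_mul_pow_succ φ n
  have hw1 : conj w ≠ 0 := by simpa using hw0
  induction n with
  | zero =>
    have h := step 0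
    simp only [pow_zero, one_mul, mul_one, integral_bdry_mul_kernel φ hw, sub_self] at h
    exact (mul_eq_zero.mp h).resolve_left hw1
  | succ n ih =>
    have h := step (n + 1)
    rw [ih, integral_bdry_mul_pow_succ, sub_zero] at h
    exact (mul_eq_zero.mp h).resolve_left hw1

theorem integral_bdry_mul_zc_mul_eval_mul_kernel (φ : Hardy) (p : ℂ[X]) {w : ℂ} (hw : ‖w‖ < 1) :
    ∫ x, bdry φ x * (zc x * p.eval (zc x) * kernel w x) ∂AddCircle.haarAddCircle = 0 := by
  have hk := continuous_kernel hw
  have hz := continuous_zc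
  induction p using Polynomial.induction_on' with
  | add p q hp hq =>
    have hcp := continuous_eval_zc p
    have hcq := continuous_eval_zc q
    simp only [eval_add, mul_add, add_mul]
    rw [integral_add (integrable_bdry_mul φ (by fun_prop)) (integrable_bdry_mul φ (by fun_prop)),
      hp, hq, add_zero]
  | monomial n a =>
    rw [← mul_zero a, ← integral_bdry_mul_pow_succ_mul_kernel φ hw n, ← integral_const_mul]
    congr 1
    ext x
    rw [eval_monomial]
    ring

/-- Cauchy's formula for `φ z ^ n`, by induction from `z conj k_w = z + w conj k_w`. -/
theorem integral_bdry_mul_pow_mul_conj_kernel (φ : Hardy) {w : ℂ} (hw : ‖w‖ < 1) (n : ℕ) :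
    ∫ x, bdry φ x * (zc x ^ n * conj (kernel w x)) ∂AddCircle.haarAddCircle =
      hardyEval φ w * w ^ n := by
  have hk := continuous_conj_kernel hw
  have hz := continuous_zc
  induction n with
  | zero => simp [hardyEval, projPlus, pairing]
  | succ n ih =>
    have : ∫ x, bdry φ x * (zc x ^ (n + 1) * conj (kernel w x)) ∂AddCircle.haarAddCircle =
        ∫ x, bdry φ x * zc x ^ (n + 1) ∂AddCircle.haarAddCircle +
        w * ∫ x, bdry φ x * (zc x ^ n * conj (kernel w x)) ∂AddCircle.haarAddCircle := by
      rw [← integral_const_mul, ← integral_add (integrable_bdry_mul φ (by fun_prop))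
        ((integrable_bdry_mul φ (by fun_prop)).const_mul w)]
      congr 1
      ext x
      linear_combination (bdry φ x * zc x ^ n) * conj_kernel_spec hw x
    rw [this, ih, integral_bdry_mul_pow_succ]
    ring

theorem integral_bdry_mul_eval_mul_conj_kernel (φ : Hardy) (p : ℂ[X]) {w : ℂ} (hw : ‖w‖ < 1) :
    ∫ x, bdry φ x * (p.eval (zc x) * conj (kernel w x)) ∂AddCircle.haarAddCircle =
      hardyEval φ w * p.eval w := by
  have hk := continuous_conj_kernel hw
  have hz := continuous_zc
  induction p using Polynomial.induction_on' with
  | add p q hp hq =>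
    have hcp := continuous_eval_zc p
    have hcq := continuous_eval_zc q
    simp only [eval_add, mul_add, add_mul]
    rw [integral_add (integrable_bdry_mul φ (by fun_prop)) (integrable_bdry_mul φ (by fun_prop)),
      hp, hq]
  | monomial n a =>
    rw [eval_monomial, mul_left_comm, ← integral_bdry_mul_pow_mul_conj_kernel φ hw n,
      ← integral_const_mul]
    congr 1
    ext x
    rw [eval_monomial]
    ring

/-- Cauchy integrals of integrable functions are analytic in the disc. -/
theorem differentiableOn_projPlus {f : UnitAddCircle → ℂ}
    (hf : Integrable f AddCircle.haarAddCircle) : DifferentiableOn ℂ (projPlus f) unitDisc := by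
  intro w₀ hw₀
  rw [mem_unitDisc] at hw₀
  refine DifferentiableAt.differentiableWithinAt ?_
  -- On the disc of radius `ρ < 1` the kernels are bounded by `1 / (1 - ρ)`, which dominates the
  -- derivative of the integrand.
  obtain ⟨ρ, hρ₀, hρ⟩ := exists_between hw₀
  have hs : Metric.ball (0 : ℂ) ρ ∈ nhds w₀ :=
    Metric.isOpen_ball.mem_nhds (by simpa using hρ₀)
  have hlt : ∀ w ∈ Metric.ball (0 : ℂ) ρ, ‖w‖ < 1 := fun w hw =>
    (mem_ball_zero_iff.mp hw).trans hρ
  have hcz : Continuous fun x => conj (zc x) := Complex.continuous_conj.comp continuous_zc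
  have hint : ∀ w, ‖w‖ < 1 → Integrable (fun x => f x * conj (kernel w x))
      AddCircle.haarAddCircle := fun w hw =>
    integrable_mul_continuous hf (continuous_conj_kernel hw)
  refine (hasDerivAt_integral_of_dominated_loc_of_deriv_le (μ := AddCircle.haarAddCircle)
    (F := fun w x => f x * conj (kernel w x))
    (F' := fun w x => f x * (conj (zc x) * conj (kernel w x) ^ 2))
    (bound := fun x => ‖f x‖ * ((1 - ρ)⁻¹ ^ 2)) hs ?_ (hint w₀ hw₀) ?_ ?_ ?_ ?_).2.differentiableAt
  · filter_upwards [hs] with w hw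
    exact (hint w (hlt w hw)).aestronglyMeasurable
  · have hk := continuous_conj_kernel hw₀
    exact (integrable_mul_continuous hf (by fun_prop)).aestronglyMeasurable
  · refine Filter.Eventually.of_forall fun x w hw => ?_
    rw [norm_mul, norm_mul, norm_pow, RCLike.norm_conj, norm_zc, one_mul, conj_kernel, norm_div,
      norm_one, one_div]
    have h1 : 1 - ρ ≤ ‖1 - w * conj (zc x)‖ := by
      have := norm_sub_norm_le (1 : ℂ) (w * conj (zc x))
      rw [norm_one, norm_mul, RCLike.norm_conj, norm_zc, mul_one] at this
      have := mem_ball_zero_iff.mp hw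
      linarith
    have h2 : 0 < 1 - ρ := by linarith
    gcongr
  · exact hf.norm.mul_const _
  · refine Filter.Eventually.of_forall fun x w hw => ?_
    have hne := kernel_denom_ne (hlt w hw) x
    simp only [conj_kernel, one_div]
    have h1 : HasDerivAt (fun w : ℂ => 1 - w * conj (zc x)) (-conj (zc x)) w := by
      simpa using ((hasDerivAt_id w).mul_const (conj (zc x))).const_sub 1
    refine ((h1.inv hne).const_mul (f x)).congr_deriv ?_
    rw [neg_neg, div_eq_mul_inv, inv_pow]

theorem differentiableOn_hardyEval (φ : Hardy) : DifferentiableOn ℂ (hardyEval φ) unitDisc :=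
  differentiableOn_projPlus (integrable_bdry φ)

theorem zc_sub_ne {w : ℂ} (hw : ‖w‖ < 1) (x : UnitAddCircle) : w - zc x ≠ 0 := by
  intro h
  rw [sub_eq_zero] at h
  rw [h, norm_zc] at hw
  exact lt_irrefl _ hw

theorem div_sub_zc_eq {w : ℂ} (hw : ‖w‖ < 1) (c : ℂ) (x : UnitAddCircle) :
    c / (w - zc x) = -(c * conj (zc x)) * conj (kernel w x) := by
  rw [div_eq_iff (zc_sub_ne hw x)]
  linear_combination -(c * conj (zc x)) * conj_kernel_spec hw x - c * zc_mul_conj x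

theorem differentiableOn_gammaMinus (φ : Hardy) (r : RatD) :
    DifferentiableOn ℂ (fun w => GammaMinus φ w r) unitDisc := by
  have hr := continuous_ratEval r
  have hcz : Continuous fun x => conj (zc x) := Complex.continuous_conj.comp continuous_zc
  have hcr : Continuous fun x => conj (ratEval r (zc x)) := Complex.continuous_conj.comp hr
  refine (differentiableOn_projPlus (f := fun x => bdry φ x * (-(conj (zc x)) *
    conj (ratEval r (zc x)))) (integrable_bdry_mul φ (by fun_prop))).congr fun w hw => ?_
  unfold GammaMinus projPlus pairing
  congr 1
  ext x
  beta_reduce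
  rw [div_sub_zc_eq (mem_unitDisc.mp hw)]
  ring

/-- The divided difference of a polynomial, integrated against a continuous function. -/
theorem exists_integral_dividedDifference (φ : Hardy) {b : UnitAddCircle → ℂ} (hb : Continuous b)
    {Q : ℂ[X]} {N : ℕ} (hQ : Q.natDegree ≤ N + 1) :
    ∃ (F : ℂ[X]) (D : ℂ → UnitAddCircle → ℂ), F.natDegree ≤ N ∧ (∀ w, Continuous (D w)) ∧
      (∀ w x, D w x * (w - zc x) = Q.eval w - Q.eval (zc x)) ∧
      ∀ w, ∫ x, bdry φ x * (b x * D w x) ∂AddCircle.haarAddCircle = F.eval w := by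
  have hz := continuous_zc
  -- Expand `(w ^ k - z ^ k) / (w - z)` as a geometric sum for each monomial of `Q` and collect
  -- powers of `w`.
  refine ⟨∑ k ∈ Finset.range (N + 2), ∑ i ∈ Finset.range k,
    monomial i (Q.coeff k * ∫ x, bdry φ x * (b x * zc x ^ (k - 1 - i)) ∂AddCircle.haarAddCircle),
    fun w x => ∑ k ∈ Finset.range (N + 2), Q.coeff k *
      ∑ i ∈ Finset.range k, w ^ i * zc x ^ (k - 1 - i), ?_, ?_, ?_, ?_⟩
  · refine natDegree_sum_le_of_forall_le _ _ fun k hk =>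
      natDegree_sum_le_of_forall_le _ _ fun i hi => (natDegree_monomial_le _).trans ?_
    rw [Finset.mem_range] at hk hi
    omega
  · intro w
    fun_prop
  · intro w x
    rw [eval_eq_sum_range' (n := N + 2) (by omega), eval_eq_sum_range' (n := N + 2) (by omega),
      Finset.sum_mul, ← Finset.sum_sub_distrib]
    refine Finset.sum_congr rfl fun k _ => ?_
    rw [mul_assoc, (Commute.all w (zc x)).geom_sum₂_mul]
    ring
  · intro w
    simp only [eval_finsetSum, eval_monomial, Finset.mul_sum]
    rw [integral_finsetSum _ fun k _ => integrable_finsetSum _ fun i _ =>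
      integrable_bdry_mul φ (by fun_prop)]
    refine Finset.sum_congr rfl fun k _ => ?_
    rw [integral_finsetSum _ fun i _ => integrable_bdry_mul φ (by fun_prop)]
    refine Finset.sum_congr rfl fun i _ => ?_
    rw [mul_right_comm, ← integral_const_mul]
    congr 1
    ext x
    ring

/-- The common principal part of `Γ₊` and `Γ₋`, as a polynomial over the reflected denominator. -/
theorem IsFrac.exists_principalPart (φ : Hardy) {r : RatD} {p q : ℂ[X]} {N : ℕ}
    (h : IsFrac r p q N) :
    ∃ F : ℂ[X], F.natDegree ≤ N ∧
      (∀ w, ‖w‖ < 1 → (conjReflect (N + 1) q).eval w * GammaMinus φ w r =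
        F.eval w - hardyEval φ w * (conjReflect N p).eval w) ∧
      RatD.ofPoly q * gammaPlus φ r = RatD.ofPoly (conjReflect (N + 1) F) := by
  have hr := continuous_ratEval r
  have hz := continuous_zc
  have hcz : Continuous fun x => conj (zc x) := Complex.continuous_conj.comp continuous_zc
  have hcr : Continuous fun x => conj (ratEval r (zc x)) := Complex.continuous_conj.comp hr
  have hP := continuous_eval_zc (conjReflect N p)
  -- `F(w) = ∫ φ conj r (Q(w) - Q(z)) / (w - z)`. The term with `Q(w)` is `Q(w)` times a Cauchy
  -- integral. In the term with `Q(z)`, `Q conj r = z P`: for `|w| < 1` the Cauchy formula then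
  -- yields `φ(w) P(w)`, and at the reflected point `1 / conj w` outside the disc the integral
  -- vanishes.
  obtain ⟨F, D, hF, hDc, hD, hFD⟩ := exists_integral_dividedDifference φ hcr
    (natDegree_conjReflect_le h.natDegree_den)
  refine ⟨F, hF, fun w hw => ?_, ratD_ext fun w hw0 hw => ?_⟩
  · have hk := continuous_conj_kernel hw
    have hDw := hDc w
    rw [← hFD, ← integral_bdry_mul_eval_mul_conj_kernel φ _ hw,
      ← integral_sub (integrable_bdry_mul φ (by fun_prop)) (integrable_bdry_mul φ (by fun_prop)),
      GammaMinus, pairing, ← integral_const_mul]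
    congr 1
    ext x
    have h1 := hD w x
    have h2 := h.conj_eval_zc x
    have h3 := conj_kernel_spec hw x
    have h4 := zc_sub_ne hw x
    field_simp
    linear_combination bdry φ x * (-(conj (ratEval r (zc x))) * h1 + h2 -
      (conjReflect N p).eval (zc x) * h3)
  · have hk := continuous_kernel hw
    have hw1 : conj w ≠ 0 := by simpa using hw0
    have hDw := hDc (conj w)⁻¹
    rw [ratEval_mul _ _ hw.le, ratEval_ofPoly, ratEval_ofPoly,
      eval_conjReflect (N := N + 1) (by omega) hw0, gammaPlus, ratEval_mul _ _ hw.le,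
      toeplitz_val φ r w hw, RatD.z, ratEval_ofPoly, eval_X]
    have hq : q.eval w = w ^ (N + 1) * conj ((conjReflect (N + 1) q).eval (conj w)⁻¹) := by
      rw [← eval_conjReflect (natDegree_conjReflect_le h.natDegree_den) hw0,
        conjReflect_conjReflect]
    have key : (conjReflect (N + 1) q).eval (conj w)⁻¹ *
        ∫ x, bdry φ x * (conj (ratEval r (zc x)) * kernel w x) ∂AddCircle.haarAddCircle =
        (conj w)⁻¹ * F.eval (conj w)⁻¹ := by
      rw [← hFD, ← integral_const_mul, ← integral_const_mul,
        ← add_zero (∫ x, (conj w)⁻¹ * _ ∂AddCircle.haarAddCircle),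
        ← integral_bdry_mul_zc_mul_eval_mul_kernel φ (conjReflect N p) hw,
        ← integral_add ((integrable_bdry_mul φ (by fun_prop)).const_mul _)
          (integrable_bdry_mul φ (by fun_prop))]
      congr 1
      ext x
      have h1 := hD (conj w)⁻¹ x
      have h2 := h.conj_eval_zc x
      have h3 := kernel_spec hw x
      have h4 : D (conj w)⁻¹ x * (1 - conj w * zc x) =
          conj w * ((conjReflect (N + 1) q).eval (conj w)⁻¹ -
            (conjReflect (N + 1) q).eval (zc x)) := by
        rw [← h1]
        field_simp
      have h5 : D (conj w)⁻¹ x = conj w * ((conjReflect (N + 1) q).eval (conj w)⁻¹ -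
            (conjReflect (N + 1) q).eval (zc x)) * kernel w x := by
        linear_combination kernel w x * h4 - D (conj w)⁻¹ x * h3
      rw [h5]
      field_simp
      linear_combination bdry φ x * kernel w x * h2
    have hint : projPlus (fun x => conj (bdry φ x) * ratEval r (zc x)) w =
        conj (∫ x, bdry φ x * (conj (ratEval r (zc x)) * kernel w x)
          ∂AddCircle.haarAddCircle) := by
      rw [← integral_conj, projPlus, pairing]
      congr 1
      ext x
      simp [mul_assoc]
    have key' := congrArg conj key
    simp only [map_mul, map_inv₀, Complex.conj_conj] at key'
    rw [hq, hint]
    have : w⁻¹ * w = 1 := inv_mul_cancel₀ hw0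
    linear_combination w ^ (N + 1) * w * key' + w ^ (N + 1) * conj (F.eval (conj w)⁻¹) * this

end Integrals

/-! ### The symbol polynomial and its multiplicativity -/

section Symbol

/-- `r = p / q`, together with the polynomial `B` for which, with reflected numerator `P` and
reflected denominator `Q`, the function `1 - Γ₊(·; r)` is the reflection of `B / Q`, and
`1 - Γ₋(·; r) = (B + φ P) / Q`. -/
structure IsSymbol (φ : Hardy) (r : RatD) (p q : ℂ[X]) (N : ℕ) (B : ℂ[X]) : Prop
    extends IsFrac r p q N where
  natDegree_sub : (conjReflect (N + 1) q - B).natDegree ≤ N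
  minus : ∀ w, ‖w‖ < 1 → (conjReflect (N + 1) q).eval w * (1 - GammaMinus φ w r) =
    B.eval w + hardyEval φ w * (conjReflect N p).eval w
  plus : RatD.ofPoly q * (1 - gammaPlus φ r) = RatD.ofPoly (conjReflect (N + 1) B)

theorem IsFrac.exists_isSymbol (φ : Hardy) {r : RatD} {p q : ℂ[X]} {N : ℕ}
    (h : IsFrac r p q N) : ∃ B, IsSymbol φ r p q N B := by
  obtain ⟨F, hF, hm, hp⟩ := h.exists_principalPart φ
  refine ⟨conjReflect (N + 1) q - F, h, by rwa [sub_sub_cancel], fun w hw => ?_, ?_⟩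
  · rw [mul_sub, hm w hw, eval_sub]
    ring
  · rw [mul_sub, hp, conjReflect_sub, RatD.ofPoly_sub, conjReflect_conjReflect, mul_one]

theorem gammaPlus_zero (φ : Hardy) : gammaPlus φ 0 = 0 := by
  have : toeplitz φ 0 = 0 := ratD_ext fun w _ hw => by
    rw [toeplitz_val φ 0 w hw, ratEval_zero]
    simp [projPlus, pairing, ratEval_zero]
  rw [gammaPlus, this, mul_zero]

theorem gammaMinus_zero (φ : Hardy) (w : ℂ) : GammaMinus φ w 0 = 0 := by
  simp [GammaMinus, pairing, ratEval_zero]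

theorem circ_eq (φ : Hardy) (r s : RatD) :
    circ φ r s = r * (1 - gammaPlus φ s) + s * (1 - gammaPlus φ r) +
      toeplitz φ (RatD.z * r * s) := by
  unfold circ times gammaPlus
  ring

namespace IsSymbol

variable {φ : Hardy} {r s : RatD} {p q p' q' B B' : ℂ[X]} {N N' : ℕ}

theorem natDegree_le (h : IsSymbol φ r p q N B) : B.natDegree ≤ N + 1 := by
  have h1 : B = conjReflect (N + 1) q - (conjReflect (N + 1) q - B) := by ring
  rw [h1]
  refine (natDegree_sub_le _ _).trans (max_le h.natDegree_reflect_den.le ?_)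
  exact h.natDegree_sub.trans (Nat.le_succ N)

theorem coeff_succ (h : IsSymbol φ r p q N B) :
    B.coeff (N + 1) = (conjReflect (N + 1) q).coeff (N + 1) := by
  have := coeff_eq_zero_of_natDegree_lt (Nat.lt_succ_of_le h.natDegree_sub)
  rw [coeff_sub, sub_eq_zero] at this
  exact this.symm

theorem coeff_succ_ne_zero (h : IsSymbol φ r p q N B) : B.coeff (N + 1) ≠ 0 := by
  rw [h.coeff_succ, coeff_conjReflect_self]
  simpa using h.den_ne 0 (by simp)

theorem continuousOn_minus (φ : Hardy) (r : RatD) :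
    ContinuousOn (fun w => 1 - GammaMinus φ w r) unitDisc :=
  continuousOn_const.sub (differentiableOn_gammaMinus φ r).continuousOn

/-- Uniqueness of the principal part. -/
theorem unique (h : IsSymbol φ r p q N B) {A : ℂ[X]} {M : ℂ → ℂ}
    (hA : (conjReflect (N + 1) q - A).natDegree ≤ N) (hM : ContinuousOn M unitDisc)
    (hAM : ∀ w, ‖w‖ < 1 → (conjReflect (N + 1) q).eval w * M w =
      A.eval w + hardyEval φ w * (conjReflect N p).eval w) :
    B = A ∧ ∀ w, ‖w‖ < 1 → 1 - GammaMinus φ w r = M w := by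
  -- Subtracting the two representations eliminates `φ P`. What remains is divisible by `Q` but of
  -- smaller degree.
  have hdvd : conjReflect (N + 1) q ∣ B - A :=
    dvd_of_eval_eq_mul h.reflect_den_ne_zero (fun a => h.reflect_den_root)
      ((continuousOn_minus φ r).sub hM) fun w hw => by
        simp only [Pi.sub_apply, eval_sub]
        linear_combination hAM w hw - h.minus w hw
  have h0 : B - A = 0 := by
    refine eq_zero_of_dvd_of_natDegree_lt hdvd ?_
    rw [h.natDegree_reflect_den, Nat.lt_succ_iff]
    have h1 : B - A = (conjReflect (N + 1) q - A) - (conjReflect (N + 1) q - B) := by ring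
    rw [h1]
    exact (natDegree_sub_le _ _).trans (max_le hA h.natDegree_sub)
  rw [sub_eq_zero] at h0
  refine ⟨h0, fun w hw => eq_of_eval_mul_eq h.reflect_den_ne_zero (continuousOn_minus φ r) hM
    (fun w hw => ?_) hw⟩
  rw [hAM w hw, ← h0, h.minus w hw]

/-- The symbols of `r ∘ s`. -/
theorem circ (h : IsSymbol φ r p q N B) (h' : IsSymbol φ s p' q' N' B') :
    ∃ c, IsSymbol φ (circ φ r s) c (q * q') (N + N' + 1) (B * B') ∧
      (∀ w, ‖w‖ < 1 → 1 - GammaMinus φ w (HardyCircle.circ φ r s) =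
        (1 - GammaMinus φ w r) * (1 - GammaMinus φ w s) +
          hardyEval φ w * GammaMinus φ w (RatD.z * r * s)) ∧
      ∀ w, ‖w‖ < 1 → (conjReflect (N + N' + 1) c).eval w =
        (conjReflect N p).eval w * B'.eval w + (conjReflect N' p').eval w * B.eval w +
        hardyEval φ w * (conjReflect N p).eval w * (conjReflect N' p').eval w +
        (conjReflect (N + 1) q).eval w * (conjReflect (N' + 1) q').eval w *
          GammaMinus φ w (RatD.z * r * s) := by
  have hz := h.zmul h'.toIsFrac
  obtain ⟨F, hF, hFm, hFp⟩ := hz.exists_principalPart φ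
  rw [h.reflect_den_mul h'.toIsFrac, h.reflect_num_zmul h'.toIsFrac] at hFm
  simp only [eval_mul] at hFm
  have hB := h.natDegree_le
  have hB' := h'.natDegree_le
  have hb := natDegree_conjReflect_le hB
  have hb' := natDegree_conjReflect_le hB'
  have hp := h.natDegree_num
  have hp' := h'.natDegree_num
  have hd₁ : (p * conjReflect (N' + 1) B').natDegree ≤ N + N' + 1 :=
    natDegree_mul_le.trans (by omega)
  have hd₂ : (p' * conjReflect (N + 1) B).natDegree ≤ N + N' + 1 :=
    natDegree_mul_le.trans (by omega)
  -- `γ₊` carries an extra factor `z`, matched by the factor `X` gained on reflecting `F` at order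
  -- one higher.
  have hT : RatD.ofPoly (q * q') * toeplitz φ (RatD.z * r * s) =
      RatD.ofPoly (conjReflect (N + N' + 1) F) := by
    refine mul_left_cancel₀ (RatD.ofPoly_ne_zero X_ne_zero) ?_
    rw [← RatD.ofPoly_mul X, ← conjReflect_succ hF, ← hFp, gammaPlus, RatD.z]
    ring
  set c := p * conjReflect (N' + 1) B' + p' * conjReflect (N + 1) B +
    conjReflect (N + N' + 1) F with hc
  have hfrac : IsFrac (HardyCircle.circ φ r s) c (q * q') (N + N' + 1) := by
    refine ⟨?_, hz.natDegree_den, hz.den_ne, ?_⟩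
    · refine natDegree_add_le_of_degree_le (natDegree_add_le_of_degree_le hd₁ hd₂) ?_
      exact natDegree_conjReflect_le hF
    · rw [circ_eq, mul_add, hT, hc, RatD.ofPoly_add, RatD.ofPoly_add, RatD.ofPoly_mul p,
        RatD.ofPoly_mul p', ← h.plus, ← h'.plus, ← h.eq, ← h'.eq, RatD.ofPoly_mul]
      ring
  have hcr : conjReflect (N + N' + 1) c =
      conjReflect N p * B' + conjReflect N' p' * B + F := by
    rw [hc, conjReflect_add, conjReflect_add, conjReflect_conjReflect, add_assoc N N' 1,
      conjReflect_mul hp hb', conjReflect_conjReflect,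
      show N + (N' + 1) = N' + (N + 1) by ring, conjReflect_mul hp' hb, conjReflect_conjReflect]
  have hval : ∀ w, ‖w‖ < 1 → (conjReflect (N + N' + 1) c).eval w =
      (conjReflect N p).eval w * B'.eval w + (conjReflect N' p').eval w * B.eval w +
      hardyEval φ w * (conjReflect N p).eval w * (conjReflect N' p').eval w +
      (conjReflect (N + 1) q).eval w * (conjReflect (N' + 1) q').eval w *
        GammaMinus φ w (RatD.z * r * s) := by
    intro w hw
    rw [hcr]
    simp only [eval_add, eval_mul]
    linear_combination -hFm w hw
  -- Multiplying `B + φ P` by `B' + φ P'` and adding `φ Q Q' Γ₋(·; z r s)` gives `B B' + φ C`, with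
  -- `C` the reflected numerator of `r ∘ s`. Uniqueness of the principal part then yields both the
  -- symbol and the formula for `1 - Γ₋`.
  obtain ⟨A, hA⟩ := hfrac.exists_isSymbol φ
  have huniq := hA.unique (A := B * B') (M := fun w => (1 - GammaMinus φ w r) *
    (1 - GammaMinus φ w s) + hardyEval φ w * GammaMinus φ w (RatD.z * r * s)) ?_ ?_ ?_
  · obtain ⟨rfl, hM⟩ := huniq
    exact ⟨c, hA, hM, hval⟩
  · rw [h.reflect_den_mul h'.toIsFrac]
    have h1 : conjReflect (N + 1) q * conjReflect (N' + 1) q' - B * B' =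
        (conjReflect (N + 1) q - B) * conjReflect (N' + 1) q' +
          B * (conjReflect (N' + 1) q' - B') := by ring
    rw [h1]
    have := h.natDegree_sub
    have := h'.natDegree_sub
    have := h'.natDegree_reflect_den
    exact natDegree_add_le_of_degree_le (natDegree_mul_le.trans (by omega))
      (natDegree_mul_le.trans (by omega))
  · exact ((continuousOn_minus φ r).mul (continuousOn_minus φ s)).add
      ((differentiableOn_hardyEval φ).continuousOn.mul
        (differentiableOn_gammaMinus φ _).continuousOn)
  · intro w hw
    rw [h.reflect_den_mul h'.toIsFrac, hval w hw]
    simp only [eval_mul]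
    linear_combination (conjReflect (N' + 1) q').eval w * (1 - GammaMinus φ w s) * h.minus w hw +
      (B.eval w + hardyEval φ w * (conjReflect N p).eval w) * h'.minus w hw

end IsSymbol

theorem exists_isSymbol (φ : Hardy) (r : RatD) : ∃ p q N B, IsSymbol φ r p q N B := by
  obtain ⟨p, q, N, h⟩ := exists_isFrac r
  exact ⟨p, q, N, h.exists_isSymbol φ⟩

theorem one_sub_gammaPlus_circ (φ : Hardy) (r s : RatD) :
    1 - gammaPlus φ (circ φ r s) = (1 - gammaPlus φ r) * (1 - gammaPlus φ s) := by
  obtain ⟨p, q, N, B, h⟩ := exists_isSymbol φ r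
  obtain ⟨p', q', N', B', h'⟩ := exists_isSymbol φ s
  obtain ⟨c, hc, -⟩ := h.circ h'
  refine mul_left_cancel₀ (RatD.ofPoly_ne_zero hc.den_ne_zero) ?_
  rw [hc.plus, show N + N' + 1 + 1 = N + 1 + (N' + 1) by ring,
    conjReflect_mul h.natDegree_le h'.natDegree_le, RatD.ofPoly_mul, RatD.ofPoly_mul, ← h.plus,
    ← h'.plus]
  ring

theorem one_sub_gammaMinus_circ (φ : Hardy) (r s : RatD) {w : ℂ} (hw : ‖w‖ < 1) :
    1 - GammaMinus φ w (circ φ r s) = (1 - GammaMinus φ w r) * (1 - GammaMinus φ w s) +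
      hardyEval φ w * GammaMinus φ w (RatD.z * r * s) := by
  obtain ⟨p, q, N, B, h⟩ := exists_isSymbol φ r
  obtain ⟨p', q', N', B', h'⟩ := exists_isSymbol φ s
  obtain ⟨c, -, hM, -⟩ := h.circ h'
  exact hM w hw

/-- Necessity of the criterion for circle invertibility. -/
theorem CircleInvertible.isUnit_and_ne {φ : Hardy} {t : RatD} (h : CircleInvertible φ t) :
    IsUnit (1 - gammaPlus φ t) ∧
      ∀ a : ℂ, ‖a‖ < 1 → hardyEval φ a = 0 → GammaMinus φ a t ≠ 1 := by
  obtain ⟨t', ht'⟩ := h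
  constructor
  · have := one_sub_gammaPlus_circ φ t t'
    rw [ht', gammaPlus_zero, sub_zero] at this
    exact IsUnit.of_mul_eq_one _ this.symm
  · intro a ha hφ h1
    have := one_sub_gammaMinus_circ φ t t' ha
    rw [ht', gammaMinus_zero, hφ, h1] at this
    simp at this

theorem analyticOrderAt_one_sub_gammaPlus_circ {φ : Hardy} (r : RatD) {t : RatD}
    (ht : IsUnit (1 - gammaPlus φ t)) {w : ℂ} (hw : ‖w‖ ≤ 1) :
    analyticOrderAt (fun u => 1 - GammaPlus φ u r) w =
      analyticOrderAt (fun u => 1 - GammaPlus φ u (circ φ r t)) w := by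
  obtain ⟨p, q, N, B, h⟩ := exists_isSymbol φ r
  obtain ⟨p', q', N', B', h'⟩ := exists_isSymbol φ t
  obtain ⟨c, hc, -⟩ := h.circ h'
  have h1 := analyticOrderAt_one_sub_ratEval hw (h.den_ne w hw) h.plus
  have h2 := analyticOrderAt_one_sub_ratEval hw (hc.den_ne w hw) hc.plus
  have h3 := (isUnit_iff_of_mul_eq h'.den_ne h'.plus).mp ht w hw
  have h4 : (fun u => (conjReflect (N + N' + 1 + 1) (B * B')).eval u) =
      (fun u => (conjReflect (N + 1) B).eval u) * fun u => (conjReflect (N' + 1) B').eval u := by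
    rw [show N + N' + 1 + 1 = N + 1 + (N' + 1) by ring,
      conjReflect_mul h.natDegree_le h'.natDegree_le]
    ext u
    simp
  rw [h4, analyticOrderAt_mul (analyticAt_eval _ w) (analyticAt_eval _ w),
    (analyticAt_eval _ w).analyticOrderAt_eq_zero.mpr h3, add_zero] at h2
  exact h1.trans h2.symm

theorem analyticAt_one_sub_gammaMinus (φ : Hardy) (r : RatD) {w : ℂ} (hw : ‖w‖ < 1) :
    AnalyticAt ℂ (fun u => 1 - GammaMinus φ u r) w :=
  analyticAt_of_differentiableOn ((differentiableOn_const 1).sub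
    (differentiableOn_gammaMinus φ r)) hw

theorem analyticAt_hardyEval (φ : Hardy) {w : ℂ} (hw : ‖w‖ < 1) :
    AnalyticAt ℂ (hardyEval φ) w :=
  analyticAt_of_differentiableOn (differentiableOn_hardyEval φ) hw

/-- The orders of `m k` and of `m` agree up to the order of `f`, modulo `f` and if `k` is a unit. -/
theorem min_analyticOrderAt_mul_add {f m k g : ℂ → ℂ} {w : ℂ} (hf : AnalyticAt ℂ f w)
    (hm : AnalyticAt ℂ m w) (hk : AnalyticAt ℂ k w) (hg : AnalyticAt ℂ g w) (hkw : k w ≠ 0) :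
    min (analyticOrderAt f w) (analyticOrderAt m w) =
      min (analyticOrderAt f w) (analyticOrderAt (m * k + f * g) w) := by
  have h1 : analyticOrderAt (m * k) w = analyticOrderAt m w := by
    rw [analyticOrderAt_mul hm hk, hk.analyticOrderAt_eq_zero.mpr hkw, add_zero]
  have h2 : analyticOrderAt f w ≤ analyticOrderAt (f * g) w := by
    rw [analyticOrderAt_mul hf hg]
    exact le_self_add
  rcases lt_or_ge (analyticOrderAt m w) (analyticOrderAt f w) with h | h
  · rw [analyticOrderAt_add_eq_left_of_lt (by rw [h1]; exact h.trans_le h2), h1]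
  · rw [min_eq_left h, min_eq_left]
    exact (le_min (h1 ▸ h) h2).trans le_analyticOrderAt_add

/-- At a zero of `φ` the factor `1 - Γ₋(·; t)` is a unit and the error term is a multiple of `φ`;
elsewhere both minima are `0`. -/
theorem min_analyticOrderAt_gammaMinus_circ {φ : Hardy} (r : RatD) {t : RatD}
    (ht : ∀ a : ℂ, ‖a‖ < 1 → hardyEval φ a = 0 → GammaMinus φ a t ≠ 1) {w : ℂ} (hw : ‖w‖ < 1) :
    min (analyticOrderAt (hardyEval φ) w) (analyticOrderAt (fun u => 1 - GammaMinus φ u r) w) =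
      min (analyticOrderAt (hardyEval φ) w)
        (analyticOrderAt (fun u => 1 - GammaMinus φ u (circ φ r t)) w) := by
  have hφ := analyticAt_hardyEval φ hw
  by_cases h0 : hardyEval φ w = 0
  · rw [min_analyticOrderAt_mul_add hφ (analyticAt_one_sub_gammaMinus φ r hw)
      (analyticAt_one_sub_gammaMinus φ t hw)
      (analyticAt_of_differentiableOn (differentiableOn_gammaMinus φ (RatD.z * r * t)) hw)
      (sub_ne_zero.mpr (ht w hw h0).symm)]
    congr 1
    refine analyticOrderAt_congr ?_
    filter_upwards [Metric.isOpen_ball.mem_nhds (mem_unitDisc.mpr hw)] with u hu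
    exact (one_sub_gammaMinus_circ φ r t (mem_unitDisc.mp hu)).symm
  · simp [hφ.analyticOrderAt_eq_zero.mpr h0]

end Symbol

/-! ### Simultaneous congruences for the unknown numerator -/

section Congruence

/-- Two congruences modulo `Q` for one unknown `P`, with coefficients `m₁` and `f` that need not
be coprime to `Q`. -/
theorem exists_solution_of_congruences {f m₁ m₂ P₁ P₂ Q₁ Q₂ B₁ B₂ G h Q a b c : ℂ[X]}
    (hQ : Q = B₁ * Q₂) (hQ0 : Q ≠ 0)
    (e₁ : Q ^ 2 ∣ Q₁ * m₁ - (G * B₁ + f * P₁)) (e₂ : Q ^ 2 ∣ Q₂ * m₂ - (G * B₂ + f * P₂))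
    (hG : IsCoprime G Q) (hf : h ∣ f) (hm₁ : h ∣ m₁) (hm₂ : h ∣ m₂) (hQh : h ∣ Q ^ 2)
    (hab : a * f + b * m₁ + c * Q ^ 2 = h) (hdeg : 0 < Q.natDegree) :
    ∃ P m, P.natDegree < Q.natDegree ∧ Q ∣ m₁ * P - (P₂ * B₁ - P₁ * B₂) ∧
      f * P + B₂ * Q₁ = Q * m ∧
      ∀ z, h.eval z = 0 → ∀ f', f = h * f' → f'.eval z ≠ 0 → m.eval z ≠ 0 := by
  have hh0 : h ≠ 0 := by
    rintro rfl
    exact pow_ne_zero 2 hQ0 (zero_dvd_iff.mp hQh)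
  have hGh : IsCoprime h G := (hG.symm.pow_left (m := 2)).of_isCoprime_of_dvd_left hQh
  -- Modulo `h`, where `f`, `m₁`, `m₂` and `Q ^ 2` vanish, `e₁` and `e₂` reduce to `G B₁ ≡ 0` and `G
  -- B₂ ≡ 0`; `G` is a unit there.
  have hB₁ : h ∣ B₁ := by
    refine hGh.dvd_of_dvd_mul_left ?_
    have := dvd_sub (dvd_sub (hm₁.mul_left Q₁) (hQh.trans e₁)) (hf.mul_right P₁)
    convert this using 1
    ring
  have hB₂ : h ∣ B₂ := by
    refine hGh.dvd_of_dvd_mul_left ?_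
    have := dvd_sub (dvd_sub (hm₂.mul_left Q₂) (hQh.trans e₂)) (hf.mul_right P₂)
    convert this using 1
    ring
  obtain ⟨f', rfl⟩ := hf
  obtain ⟨m', rfl⟩ := hm₁
  obtain ⟨m₂', rfl⟩ := hm₂
  obtain ⟨β₁, rfl⟩ := hB₁
  obtain ⟨β₂, rfl⟩ := hB₂
  obtain ⟨k₁, hk₁⟩ := e₁
  obtain ⟨k₂, hk₂⟩ := e₂
  -- After division by `h`, the congruences modulo `Q` become congruences modulo `R = Q / h` whose
  -- coefficients `f'`, `m'` generate the unit ideal modulo `R`.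
  obtain ⟨R, hR⟩ : ∃ R, R = β₁ * Q₂ := ⟨_, rfl⟩
  have hQR : Q = h * R := by rw [hQ, hR]; ring
  clear hQ hG hGh
  subst hQR
  have hbez : a * f' + b * m' + c * (h * R ^ 2) = 1 := by
    refine mul_left_cancel₀ hh0 ?_
    linear_combination hab
  -- Compatibility of the two congruences. Using `e₁`, then `e₂`, `f (P₂ B₁ - P₁ B₂) + m₁ B₂ Q₁ ≡ B₁
  -- (G B₂ + f P₂) ≡ Q m₂` up to multiples of `Q ^ 2`; divide by `h ^ 2`, using `h ∣ m₂`.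
  obtain ⟨V, hV⟩ : ∃ V, f' * (P₂ * β₁ - P₁ * β₂) - m' * (-(β₂ * Q₁)) = R * V := by
    refine ⟨m₂' + R * h * (β₂ * k₁ - β₁ * k₂), mul_left_cancel₀ (pow_ne_zero 2 hh0) ?_⟩
    linear_combination h * β₂ * hk₁ - h * β₁ * hk₂ - h ^ 2 * m₂' * hR
  -- The Bézout combination of the two right-hand sides solves both congruences, by `hV`.
  set P₀ := a * (-(β₂ * Q₁)) + b * (P₂ * β₁ - P₁ * β₂) with hP₀
  set m₀ := b * V + c * h * R * (β₂ * Q₁) with hm₀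
  have hfP : f' * P₀ + β₂ * Q₁ = R * m₀ := by
    rw [hP₀, hm₀]
    linear_combination b * hV - (β₂ * Q₁) * hbez
  have hmP : m' * P₀ - (P₂ * β₁ - P₁ * β₂) =
      R * (-a * V - c * h * R * (P₂ * β₁ - P₁ * β₂)) := by
    rw [hP₀]
    linear_combination -a * hV + (P₂ * β₁ - P₁ * β₂) * hbez
  -- Adding `κ R` to `P₀` preserves both congruences and changes `m` by `κ f'`. Each root of `h`
  -- with `f' ≠ 0` excludes one value of `κ`. The final reduction modulo `h R` changes `m` by a
  -- multiple of `h`, invisible at these roots.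
  obtain ⟨κ, hκ⟩ := Infinite.exists_notMem_finset
    (h.roots.toFinset.image fun z => -(m₀.eval z) / f'.eval z)
  set d := (P₀ + C κ * R) / (h * R) with hd
  refine ⟨(P₀ + C κ * R) % (h * R), m₀ + C κ * f' - h * f' * d,
    natDegree_mod_lt _ hdeg.ne', ?_, ?_, ?_⟩
  · rw [EuclideanDomain.mod_eq_sub_mul_div, ← hd]
    exact ⟨(-a * V - c * h * R * (P₂ * β₁ - P₁ * β₂)) + m' * C κ - h * m' * d, by
      linear_combination h * hmP⟩
  · rw [EuclideanDomain.mod_eq_sub_mul_div, ← hd]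
    linear_combination h * hfP
  · intro z hz f'' hf'' hz' h0
    obtain rfl := mul_left_cancel₀ hh0 hf''
    apply hκ
    rw [Finset.mem_image]
    refine ⟨z, by simpa [hh0] using hz, ?_⟩
    simp only [eval_sub, eval_add, eval_mul, eval_C, hz, zero_mul, sub_zero] at h0
    rw [div_eq_iff hz']
    linear_combination -h0

/-- Divisibility of the remainder of an analytic function modulo `W` by a divisor
`(X - a) ^ e` of `W`. -/
theorem pow_dvd_remainder_iff {F k : ℂ → ℂ} {f W : ℂ[X]} (hk : DifferentiableOn ℂ k unitDisc) (h : ∀ w, ‖w‖ < 1 → F w = f.eval w + W.eval w * k w)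
    {a : ℂ} (ha : ‖a‖ < 1) {e : ℕ} (he : (X - C a) ^ e ∣ W) :
    (X - C a) ^ e ∣ f ↔ (e : ℕ∞) ≤ analyticOrderAt F a := by
  have hWk : (e : ℕ∞) ≤ analyticOrderAt ((fun w => W.eval w) * k) a := by
    rw [analyticOrderAt_mul (analyticAt_eval W a) (analyticAt_of_differentiableOn hk ha)]
    exact ((pow_dvd_iff_le_analyticOrderAt W a e).mp he).trans le_self_add
  have hU : unitDisc ∈ nhds a := Metric.isOpen_ball.mem_nhds (mem_unitDisc.mpr ha)
  have h1 : F =ᶠ[nhds a] (fun w => f.eval w) + (fun w => W.eval w) * k := by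
    filter_upwards [hU] with w hw
    exact h w (mem_unitDisc.mp hw)
  have h2 : (fun w => f.eval w) =ᶠ[nhds a] F - (fun w => W.eval w) * k := by
    filter_upwards [h1] with w hw
    rw [Pi.sub_apply, hw]
    simp
  rw [pow_dvd_iff_le_analyticOrderAt]
  constructor
  · intro hf
    rw [analyticOrderAt_congr h1]
    exact (le_min hf hWk).trans le_analyticOrderAt_add
  · intro hf
    rw [analyticOrderAt_congr h2]
    exact (le_min hf hWk).trans le_analyticOrderAt_sub

theorem isCoprime_of_eval {p q : ℂ[X]} (h : ∀ a, p.eval a = 0 → q.eval a ≠ 0) :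
    IsCoprime p q := by
  rw [isCoprime_iff_aeval_ne_zero_of_isAlgClosed ℂ ℂ]
  intro a
  by_cases ha : p.eval a = 0
  · exact Or.inr (by simpa using h a ha)
  · exact Or.inl (by simpa using ha)

end Congruence

/-! ### Construction of the solution of `r ∘ t = s` -/

section Sufficiency

/-- The factorization of the numerators of `1 - Γ₊` for elements with the same zeros of `1 - Γ₊`
in the closed disc. -/
theorem IsSymbol.exists_factorization {φ : Hardy} {r s : RatD} {p₁ q₁ A₁ p₂ q₂ A₂ : ℂ[X]}
    {N₁ N₂ : ℕ} (h₁ : IsSymbol φ r p₁ q₁ N₁ A₁) (h₂ : IsSymbol φ s p₂ q₂ N₂ A₂)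
    (hA : ConditionA φ r s) :
    ∃ (G B₁ B₂ : ℂ[X]) (k n₁ n₂ : ℕ), A₁ = G * B₁ ∧ A₂ = G * B₂ ∧ k + n₁ = N₁ + 1 ∧
      k + n₂ = N₂ + 1 ∧ G.natDegree ≤ k ∧ B₁.natDegree = n₁ ∧ B₂.natDegree = n₂ ∧
      (∀ a, ‖a‖ < 1 → G.eval a ≠ 0) ∧ (∀ a, B₁.eval a = 0 → ‖a‖ < 1) ∧
      ∀ a, B₂.eval a = 0 → ‖a‖ < 1 := by
  have hb₁ : (conjReflect (N₁ + 1) A₁).eval 0 ≠ 0 := by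
    rw [eval_zero_conjReflect]
    simpa using h₁.coeff_succ_ne_zero
  have hb₂ : (conjReflect (N₂ + 1) A₂).eval 0 ≠ 0 := by
    rw [eval_zero_conjReflect]
    simpa using h₂.coeff_succ_ne_zero
  have hne₁ : conjReflect (N₁ + 1) A₁ ≠ 0 := fun h => hb₁ (by rw [h, eval_zero])
  have hne₂ : conjReflect (N₂ + 1) A₂ ≠ 0 := fun h => hb₂ (by rw [h, eval_zero])
  obtain ⟨g, c₁, c₂, hgc₁, hgc₂, hg, hc₁, hc₂⟩ :=
    exists_common_factor hne₁ hne₂ (U := {w | ‖w‖ ≤ 1}) (by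
      intro w hw e
      rw [pow_dvd_iff_le_analyticOrderAt, pow_dvd_iff_le_analyticOrderAt,
        ← analyticOrderAt_one_sub_ratEval hw (h₁.den_ne w hw) h₁.plus,
        ← analyticOrderAt_one_sub_ratEval hw (h₂.den_ne w hw) h₂.plus]
      have := hA w hw
      unfold GammaPlus at this
      rw [this])
  have hd₁ := natDegree_conjReflect_le h₁.natDegree_le
  have hd₂ := natDegree_conjReflect_le h₂.natDegree_le
  have hg0 : g ≠ 0 := by
    rintro rfl
    exact hne₁ (by rw [hgc₁, zero_mul])
  have hc₁0 : c₁.eval 0 ≠ 0 := hc₁ 0 (by simp)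
  have hc₂0 : c₂.eval 0 ≠ 0 := hc₂ 0 (by simp)
  have hc₁' : c₁ ≠ 0 := by rintro rfl; simp at hc₁0
  have hc₂' : c₂ ≠ 0 := by rintro rfl; simp at hc₂0
  have hD₁ : g.natDegree + c₁.natDegree ≤ N₁ + 1 := by
    rwa [hgc₁, natDegree_mul hg0 hc₁'] at hd₁
  have hD₂ : g.natDegree + c₂.natDegree ≤ N₂ + 1 := by
    rwa [hgc₂, natDegree_mul hg0 hc₂'] at hd₂
  obtain ⟨n₁, hn₁⟩ := Nat.exists_eq_add_of_le (le_self_add.trans hD₁)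
  obtain ⟨n₂, hn₂⟩ := Nat.exists_eq_add_of_le (le_self_add.trans hD₂)
  have hcn₁ : c₁.natDegree ≤ n₁ := by omega
  have hcn₂ : c₂.natDegree ≤ n₂ := by omega
  -- `g` collects the zeros in the closed disc, so its reflection has none in the open disc. The
  -- `cᵢ` have no zeros in the closed disc, so their reflections have degree exactly `nᵢ` and all
  -- roots in the open disc.
  refine ⟨conjReflect g.natDegree g, conjReflect n₁ c₁, conjReflect n₂ c₂, g.natDegree, n₁, n₂,
    ?_, ?_, hn₁.symm, hn₂.symm, natDegree_conjReflect_le le_rfl, natDegree_conjReflect hcn₁ hc₁0,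
    natDegree_conjReflect hcn₂ hc₂0, ?_, ?_, ?_⟩
  · rw [← conjReflect_mul le_rfl hcn₁, ← hgc₁, ← hn₁, conjReflect_conjReflect]
  · rw [← conjReflect_mul le_rfl hcn₂, ← hgc₂, ← hn₂, conjReflect_conjReflect]
  · intro a ha h0
    rcases eq_or_ne a 0 with rfl | ha0
    · rw [eval_zero_conjReflect, map_eq_zero] at h0
      exact hg0 (leadingCoeff_eq_zero.mp h0)
    · rw [eval_conjReflect le_rfl ha0, mul_eq_zero, map_eq_zero] at h0
      have := hg _ (h0.resolve_left (pow_ne_zero _ ha0))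
      rw [Set.mem_ofPred_eq, norm_inv, RCLike.norm_conj] at this
      exact absurd ((one_lt_inv₀ (norm_pos_iff.mpr ha0)).mpr ha) (not_lt.mpr this)
  · intro a ha
    by_contra hcon
    exact conjReflect_eval_ne_zero hcn₁ hc₁ (not_lt.mp hcon) ha
  · intro a ha
    by_contra hcon
    exact conjReflect_eval_ne_zero hcn₂ hc₂ (not_lt.mp hcon) ha

end Sufficiency

section Sufficiency

/-- Solution of `r ∘ t = s` by a circle invertible `t`. -/
theorem exists_circ_eq {φ : Hardy} {r s : RatD} (hA : ConditionA φ r s) (hB : ConditionB φ r s) :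
    ∃ t, circ φ r t = s ∧ IsUnit (1 - gammaPlus φ t) ∧
      ∀ a : ℂ, ‖a‖ < 1 → hardyEval φ a = 0 → GammaMinus φ a t ≠ 1 := by
  obtain ⟨p₁, q₁, N₁, A₁, h₁⟩ := exists_isSymbol φ r
  obtain ⟨p₂, q₂, N₂, A₂, h₂⟩ := exists_isSymbol φ s
  obtain ⟨G, B₁, B₂, k, n₁, n₂, hGB₁, hGB₂, hk₁, hk₂, hGk, hBn₁, hBn₂, hG, hB₁, hB₂⟩ :=
    h₁.exists_factorization h₂ hA
  obtain ⟨P₁, hP₁⟩ : ∃ P, P = conjReflect N₁ p₁ := ⟨_, rfl⟩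
  obtain ⟨P₂, hP₂⟩ : ∃ P, P = conjReflect N₂ p₂ := ⟨_, rfl⟩
  obtain ⟨Q₁, hQ₁⟩ : ∃ Q, Q = conjReflect (N₁ + 1) q₁ := ⟨_, rfl⟩
  obtain ⟨Q₂, hQ₂⟩ : ∃ Q, Q = conjReflect (N₂ + 1) q₂ := ⟨_, rfl⟩
  have hA₁ : A₁ ≠ 0 := fun h => h₁.coeff_succ_ne_zero (by rw [h, coeff_zero])
  have hA₂ : A₂ ≠ 0 := fun h => h₂.coeff_succ_ne_zero (by rw [h, coeff_zero])
  have hB₁0 : B₁ ≠ 0 := by rintro rfl; exact hA₁ (by rw [hGB₁, mul_zero])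
  have hB₂0 : B₂ ≠ 0 := by rintro rfl; exact hA₂ (by rw [hGB₂, mul_zero])
  have hQ₁0 : Q₁ ≠ 0 := hQ₁ ▸ h₁.reflect_den_ne_zero
  have hQ₂0 : Q₂ ≠ 0 := hQ₂ ▸ h₂.reflect_den_ne_zero
  have hQ₁N : Q₁.natDegree = N₁ + 1 := hQ₁ ▸ h₁.natDegree_reflect_den
  have hQ₂N : Q₂.natDegree = N₂ + 1 := hQ₂ ▸ h₂.natDegree_reflect_den
  have hQ₁r : ∀ a, Q₁.eval a = 0 → ‖a‖ < 1 := fun a ha => h₁.reflect_den_root (hQ₁ ▸ ha)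
  have hM₁ := h₁.minus
  have hM₂ := h₂.minus
  rw [← hP₁, ← hQ₁] at hM₁
  rw [← hP₂, ← hQ₂] at hM₂
  obtain ⟨Q, hQ⟩ : ∃ Q, Q = B₁ * Q₂ := ⟨_, rfl⟩
  obtain ⟨N, hN⟩ : ∃ N, N = n₁ + N₂ := ⟨_, rfl⟩
  have hQ0 : Q ≠ 0 := hQ ▸ mul_ne_zero hB₁0 hQ₂0
  have hQN : Q.natDegree = N + 1 := by
    rw [hQ, natDegree_mul hB₁0 hQ₂0, hBn₁, hQ₂N, hN, add_assoc]
  have hQr : ∀ a, Q.eval a = 0 → ‖a‖ < 1 := by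
    intro a ha
    rw [hQ, eval_mul, mul_eq_zero] at ha
    exact ha.elim (hB₁ a) fun h => h₂.reflect_den_root (hQ₂ ▸ h)
  have hWr : ∀ a, (Q ^ 2).eval a = 0 → ‖a‖ < 1 := fun a ha => hQr a (by simpa using ha)
  have hφd := differentiableOn_hardyEval φ
  have hMd : ∀ r, DifferentiableOn ℂ (fun w => 1 - GammaMinus φ w r) unitDisc := fun r =>
    (differentiableOn_const 1).sub (differentiableOn_gammaMinus φ r)
  -- Working modulo `Q ^ 2` rather than `Q` leaves room for one more order of vanishing: if `φ` has
  -- order `d ≥ 1` at `z` and `(X - z) ^ d` divides `Q`, then `f` still detects that the order is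
  -- not `d + 1`.
  obtain ⟨f, kf, hkf, hf⟩ := exists_polynomial_remainder (pow_ne_zero 2 hQ0) hWr hφd
  obtain ⟨m₁, km₁, hkm₁, hm₁⟩ := exists_polynomial_remainder (pow_ne_zero 2 hQ0) hWr (hMd r)
  obtain ⟨m₂, km₂, hkm₂, hm₂⟩ := exists_polynomial_remainder (pow_ne_zero 2 hQ0) hWr (hMd s)
  have e₁ : Q ^ 2 ∣ Q₁ * m₁ - (G * B₁ + f * P₁) :=
    dvd_of_eval_eq_mul (pow_ne_zero 2 hQ0) hWr
      (g := fun w => kf w * P₁.eval w - Q₁.eval w * km₁ w)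
      ((hkf.continuousOn.mul (differentiableOn_eval P₁ _).continuousOn).sub
        ((differentiableOn_eval Q₁ _).continuousOn.mul hkm₁.continuousOn)) fun w hw => by
      have := hM₁ w hw
      rw [hm₁ w hw, hf w hw, hGB₁] at this
      simp only [eval_sub, eval_add, eval_mul] at this ⊢
      linear_combination this
  have e₂ : Q ^ 2 ∣ Q₂ * m₂ - (G * B₂ + f * P₂) :=
    dvd_of_eval_eq_mul (pow_ne_zero 2 hQ0) hWr
      (g := fun w => kf w * P₂.eval w - Q₂.eval w * km₂ w)
      ((hkf.continuousOn.mul (differentiableOn_eval P₂ _).continuousOn).sub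
        ((differentiableOn_eval Q₂ _).continuousOn.mul hkm₂.continuousOn)) fun w hw => by
      have := hM₂ w hw
      rw [hm₂ w hw, hf w hw, hGB₂] at this
      simp only [eval_sub, eval_add, eval_mul] at this ⊢
      linear_combination this
  obtain ⟨h, hh⟩ : ∃ h, h = EuclideanDomain.gcd f (EuclideanDomain.gcd m₁ (Q ^ 2)) := ⟨_, rfl⟩
  have hhf : h ∣ f := hh ▸ EuclideanDomain.gcd_dvd_left _ _
  have hhg : h ∣ EuclideanDomain.gcd m₁ (Q ^ 2) := hh ▸ EuclideanDomain.gcd_dvd_right _ _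
  have hhm₁ : h ∣ m₁ := hhg.trans (EuclideanDomain.gcd_dvd_left _ _)
  have hhQ : h ∣ Q ^ 2 := hhg.trans (EuclideanDomain.gcd_dvd_right _ _)
  have hh0 : h ≠ 0 := ne_zero_of_dvd_ne_zero (pow_ne_zero 2 hQ0) hhQ
  obtain ⟨a, b, c, habc⟩ : ∃ a b c, a * f + b * m₁ + c * Q ^ 2 = h := by
    have h1 := EuclideanDomain.gcd_eq_gcd_ab f (EuclideanDomain.gcd m₁ (Q ^ 2))
    have h2 := EuclideanDomain.gcd_eq_gcd_ab m₁ (Q ^ 2)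
    rw [← hh] at h1
    set y := EuclideanDomain.gcdB f (EuclideanDomain.gcd m₁ (Q ^ 2))
    exact ⟨EuclideanDomain.gcdA f (EuclideanDomain.gcd m₁ (Q ^ 2)),
      EuclideanDomain.gcdA m₁ (Q ^ 2) * y, EuclideanDomain.gcdB m₁ (Q ^ 2) * y, by
      linear_combination -h1 - y * h2⟩
  -- Condition (b) enters here: at each root of `h`, its multiplicity is at most the orders of `φ`
  -- and `1 - Γ₋(·; r)`, hence at most that of `1 - Γ₋(·; s)`.
  have hhm₂ : h ∣ m₂ := by
    refine dvd_of_forall_pow_dvd hh0 fun z e he => ?_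
    rcases Nat.eq_zero_or_pos e with rfl | he0
    · simp
    have hz : ‖z‖ < 1 := hWr z (dvd_iff_isRoot.mp
      ((dvd_pow_self _ he0.ne').trans (he.trans hhQ)))
    have hW := he.trans hhQ
    have h1 := (pow_dvd_remainder_iff hkf hf hz hW).mp (he.trans hhf)
    have h2 := (pow_dvd_remainder_iff hkm₁ hm₁ hz hW).mp (he.trans hhm₁)
    refine (pow_dvd_remainder_iff hkm₂ hm₂ hz hW).mpr ?_
    have h3 := le_min h1 h2
    rw [hB z hz] at h3
    exact h3.trans (min_le_right _ _)
  obtain ⟨P, m, hPdeg, hmP, hfP, hm⟩ := exists_solution_of_congruences hQ hQ0 e₁ e₂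
    (isCoprime_of_eval fun z hz hz' => hG z (hQr z hz') hz) hhf hhm₁ hhm₂ hhQ habc (by omega)
  have hPN : P.natDegree ≤ N := by omega
  obtain ⟨t, ht⟩ := exists_isFrac_conjReflect hPN hQN hQr
  obtain ⟨A, hA⟩ := ht.exists_isSymbol φ
  -- The first congruence makes `(B₂ Q₁ + φ P) / Q` continuous on the disc. `B₁ Q₂` and `B₂ Q₁` have
  -- equal top coefficients since those of `G Bᵢ` and `Qᵢ` agree, so the degree condition holds.
  obtain ⟨hAB, hMt⟩ := hA.unique (A := B₂ * Q₁)
    (M := fun w => m.eval w + Q.eval w * (kf w * P.eval w)) (by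
      rw [conjReflect_conjReflect, natDegree_le_iff_coeff_eq_zero]
      intro i hi
      have hd : (B₂ * Q₁).natDegree = N + 1 := by
        rw [natDegree_mul hB₂0 hQ₁0]
        omega
      rcases Nat.lt_or_ge (N + 1) i with h | h
      · rw [coeff_sub, coeff_eq_zero_of_natDegree_lt (by omega),
          coeff_eq_zero_of_natDegree_lt (by omega), sub_zero]
      · obtain rfl : i = N + 1 := by omega
        rw [coeff_sub, sub_eq_zero, hQ, show N + 1 = n₁ + (N₂ + 1) by omega,
          coeff_mul_add_eq_of_natDegree_le hBn₁.le hQ₂N.le, hQ₂, ← h₂.coeff_succ, hGB₂, ← hk₂,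
          coeff_mul_add_eq_of_natDegree_le hGk hBn₂.le,
          show n₁ + (k + n₂) = n₂ + (N₁ + 1) by omega,
          coeff_mul_add_eq_of_natDegree_le hBn₂.le hQ₁N.le, hQ₁, ← h₁.coeff_succ, hGB₁, ← hk₁,
          coeff_mul_add_eq_of_natDegree_le hGk hBn₁.le]
        ring)
    ((differentiableOn_eval m _).continuousOn.add
      ((differentiableOn_eval Q _).continuousOn.mul
        (hkf.continuousOn.mul (differentiableOn_eval P _).continuousOn)))
    (fun w hw => by
      have := congrArg (eval w) hfP
      simp only [eval_add, eval_mul] at this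
      rw [conjReflect_conjReflect, conjReflect_conjReflect, hf w hw, eval_mul, eval_pow]
      linear_combination -this)
  subst hAB
  have hq : conjReflect (N + 1) Q = conjReflect n₁ B₁ * q₂ := by
    rw [hQ, hN, add_assoc, conjReflect_mul hBn₁.le hQ₂N.le, hQ₂, conjReflect_conjReflect]
  obtain ⟨c, hc, hMc, hval⟩ := h₁.circ hA
  rw [conjReflect_conjReflect, conjReflect_conjReflect, ← hP₁, ← hQ₁] at hval
  -- Modulo `Q₁ Q` the reflected numerator of `r ∘ t` is `Q₁ (P₁ B₂ + (1 - Γ₋(·; r)) P)`, which the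
  -- second congruence turns into `P₂ Q₁ B₁`. Both sides have degree below that of `Q₁ Q`.
  have hcP : conjReflect (N₁ + N + 1) c = P₂ * Q₁ * B₁ := by
    rw [← sub_eq_zero]
    obtain ⟨u, hu⟩ := hmP
    refine eq_zero_of_dvd_of_natDegree_lt (p := Q₁ * Q) ?_ ?_
    · refine dvd_of_eval_eq_mul (mul_ne_zero hQ₁0 hQ0) (fun a ha => ?_)
        (g := fun w => u.eval w + Q.eval w * (km₁ w * P.eval w) +
          GammaMinus φ w (RatD.z * r * t)) ?_ fun w hw => ?_
      · rw [eval_mul, mul_eq_zero] at ha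
        exact ha.elim (hQ₁r a) (hQr a)
      · exact ((differentiableOn_eval u _).continuousOn.add
          ((differentiableOn_eval Q _).continuousOn.mul (hkm₁.continuousOn.mul
            (differentiableOn_eval P _).continuousOn))).add
            (differentiableOn_gammaMinus φ _).continuousOn
      · have h1 := congrArg (eval w) hu
        have h2 := hM₁ w hw
        rw [hm₁ w hw] at h2
        rw [eval_sub, hval w hw]
        simp only [eval_sub, eval_mul, eval_pow] at h1 h2 ⊢
        linear_combination Q₁.eval w * h1 - P.eval w * h2
    · rw [natDegree_mul hQ₁0 hQ0, hQ₁N, hQN]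
      have hP₂N : P₂.natDegree ≤ N₂ := hP₂ ▸ h₂.natDegree_reflect_num
      have hPQB : (P₂ * Q₁ * B₁).natDegree ≤ N₂ + (N₁ + 1) + n₁ :=
        natDegree_mul_le_of_le (natDegree_mul_le_of_le hP₂N hQ₁N.le) hBn₁.le
      have := hc.natDegree_reflect_num
      have := natDegree_sub_le (conjReflect (N₁ + N + 1) c) (P₂ * Q₁ * B₁)
      omega
  have hceq : c = p₂ * q₁ * conjReflect n₁ B₁ := by
    have hP₂N : P₂.natDegree ≤ N₂ := hP₂ ▸ h₂.natDegree_reflect_num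
    rw [← conjReflect_conjReflect (N₁ + N + 1) c, hcP,
      show N₁ + N + 1 = N₂ + (N₁ + 1) + n₁ by omega,
      conjReflect_mul (natDegree_mul_le_of_le hP₂N hQ₁N.le) hBn₁.le,
      conjReflect_mul hP₂N hQ₁N.le, hP₂, hQ₁, conjReflect_conjReflect, conjReflect_conjReflect]
  have hcirc : circ φ r t = s := by
    refine mul_left_cancel₀ (RatD.ofPoly_ne_zero hc.den_ne_zero) ?_
    rw [hc.eq, hceq, hq, RatD.ofPoly_mul, RatD.ofPoly_mul, RatD.ofPoly_mul, RatD.ofPoly_mul,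
      ← h₂.eq]
    ring
  refine ⟨t, hcirc, ?_, ?_⟩
  · rw [isUnit_iff_of_mul_eq hA.den_ne hA.plus]
    intro w hw
    rw [show N + 1 = n₂ + (N₁ + 1) by omega, conjReflect_mul hBn₂.le hQ₁N.le, eval_mul]
    refine mul_ne_zero (conjReflect_eval_ne_zero_of_coeff hBn₂.le ?_ (fun x hx h0 =>
      absurd (hB₂ x h0) (not_lt.mpr hx)) hw) ?_
    · rw [← hBn₂]
      exact leadingCoeff_ne_zero.mpr hB₂0
    · rw [hQ₁, conjReflect_conjReflect]
      exact h₁.den_ne w hw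
  · intro z hz hφz hΓ
    have hφan := analyticAt_hardyEval φ hz
    have hM₁an := analyticAt_one_sub_gammaMinus φ r hz
    have hMtan := analyticAt_one_sub_gammaMinus φ t hz
    have hU : unitDisc ∈ nhds z := Metric.isOpen_ball.mem_nhds (mem_unitDisc.mpr hz)
    -- If `1 - Γ₋(·; r)` has smaller order than `φ` at `z`, a zero of `1 - Γ₋(·; t)` would raise the
    -- order for `s = r ∘ t`, against (b). Otherwise the choice of `κ` excludes the zero.
    rcases lt_or_ge (analyticOrderAt (fun u => 1 - GammaMinus φ u r) z)
      (analyticOrderAt (hardyEval φ) z) with hlt | hge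
    · have hMt0 : 1 ≤ analyticOrderAt (fun u => 1 - GammaMinus φ u t) z := by
        rw [Order.one_le_iff_ne_zero, hMtan.analyticOrderAt_ne_zero, hΓ, sub_self]
      have hΓan := analyticAt_of_differentiableOn
        (differentiableOn_gammaMinus φ (RatD.z * r * t)) hz
      have hM₂eq : (fun u => 1 - GammaMinus φ u s) =ᶠ[nhds z]
          (fun u => 1 - GammaMinus φ u r) * (fun u => 1 - GammaMinus φ u t) +
            hardyEval φ * fun u => GammaMinus φ u (RatD.z * r * t) := by
        filter_upwards [hU] with u hu
        rw [← hcirc]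
        exact one_sub_gammaMinus_circ φ r t (mem_unitDisc.mp hu)
      have h3 : analyticOrderAt (fun u => 1 - GammaMinus φ u r) z <
          analyticOrderAt (fun u => 1 - GammaMinus φ u s) z := by
        rw [analyticOrderAt_congr hM₂eq]
        refine (lt_min ?_ ?_).trans_le le_analyticOrderAt_add
        · rw [analyticOrderAt_mul hM₁an hMtan]
          exact ((ENat.lt_add_one_iff hlt.ne_top).mpr le_rfl).trans_le
            (add_le_add_right hMt0 _)
        · rw [analyticOrderAt_mul hφan hΓan]
          exact hlt.trans_le le_self_add
      have h4 := hB z hz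
      rw [min_eq_right hlt.le] at h4
      exact absurd h4 (lt_min hlt h3).ne
    · have hpow : ∀ e : ℕ, (e : ℕ∞) ≤ analyticOrderAt (hardyEval φ) z →
          (X - C z) ^ e ∣ h ∧ (X - C z) ^ e ∣ Q := by
        intro e he
        have he₁ := he.trans hge
        have hcop : IsCoprime ((X - C z) ^ e) G :=
          (isCoprime_of_eval fun x hx => by
            rw [eval_sub, eval_X, eval_C, sub_eq_zero] at hx
            exact hx ▸ hG z hz).pow_left
        have hA₁d : (X - C z) ^ e ∣ A₁ := by
          rw [pow_dvd_iff_le_analyticOrderAt]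
          have : (fun u => A₁.eval u) =ᶠ[nhds z]
              (fun u => Q₁.eval u) * (fun u => 1 - GammaMinus φ u r) -
                hardyEval φ * fun u => P₁.eval u := by
            filter_upwards [hU] with u hu
            simp only [Pi.sub_apply, Pi.mul_apply]
            linear_combination -hM₁ u (mem_unitDisc.mp hu)
          rw [analyticOrderAt_congr this]
          refine (le_min ?_ ?_).trans le_analyticOrderAt_sub
          · rw [analyticOrderAt_mul (analyticAt_eval Q₁ z) hM₁an]
            exact he₁.trans le_add_self
          · rw [analyticOrderAt_mul hφan (analyticAt_eval P₁ z)]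
            exact he.trans le_self_add
        rw [hGB₁] at hA₁d
        have hQd : (X - C z) ^ e ∣ Q := by
          rw [hQ]
          exact (hcop.dvd_of_dvd_mul_left hA₁d).mul_right _
        have hWd : (X - C z) ^ e ∣ Q ^ 2 := hQd.trans (dvd_pow_self Q two_ne_zero)
        refine ⟨?_, hQd⟩
        rw [hh]
        exact EuclideanDomain.dvd_gcd ((pow_dvd_remainder_iff hkf hf hz hWd).mpr he)
          (EuclideanDomain.dvd_gcd ((pow_dvd_remainder_iff hkm₁ hm₁ hz hWd).mpr he₁) hWd)
      have htop : analyticOrderAt (hardyEval φ) z ≠ ⊤ := by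
        intro htop
        have h1 := natDegree_le_of_dvd (hpow (h.natDegree + 1) (by rw [htop]; exact le_top)).1 hh0
        rw [natDegree_pow, natDegree_X_sub_C] at h1
        omega
      obtain ⟨d, hd⟩ := ENat.ne_top_iff_exists.mp htop
      have hd0 : d ≠ 0 := by
        rintro rfl
        exact hφan.analyticOrderAt_ne_zero.mpr hφz (by simpa using hd.symm)
      obtain ⟨hdh, hdQ⟩ := hpow d hd.le
      have hroot : ∀ p : ℂ[X], (X - C z) ^ d ∣ p → p.eval z = 0 := fun p hp =>
        dvd_iff_isRoot.mp ((dvd_pow_self _ hd0).trans hp)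
      obtain ⟨f', hf'⟩ := id hhf
      -- Otherwise `(X - z) ^ (d + 1)` divides `f`, and also `Q ^ 2` as `d + 1 ≤ 2 d`, so `φ` would
      -- have order above `d`.
      have hf'z : f'.eval z ≠ 0 := by
        intro h0
        have h1 : (X - C z) ^ (d + 1) ∣ f := by
          rw [hf', pow_succ]
          exact mul_dvd_mul hdh (dvd_iff_isRoot.mpr h0)
        have h2 : (X - C z) ^ (d + 1) ∣ Q ^ 2 := by
          refine (pow_dvd_pow _ (show d + 1 ≤ d * 2 by omega)).trans ?_
          rw [pow_mul]
          exact pow_dvd_pow_of_dvd hdQ 2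
        have h3 := (pow_dvd_remainder_iff hkf hf hz h2).mp h1
        rw [← hd, Nat.cast_le] at h3
        omega
      have h5 := hMt z hz
      rw [hΓ, sub_self, hroot Q hdQ, zero_mul, add_zero] at h5
      exact hm z (hroot h hdh) f' hf' hf'z h5.symm

end Sufficiency

/-- Since `0 ∘ t = t`, the order invariance under such a `t` gives (a) and (b) for the pair `t`,
`0`; the solution of `t ∘ t' = 0` is then the circle inverse. -/
theorem circleInvertible_iff {φ : Hardy} {t : RatD} :
    CircleInvertible φ t ↔ IsUnit (1 - gammaPlus φ t) ∧
      ∀ a : ℂ, ‖a‖ < 1 → hardyEval φ a = 0 → GammaMinus φ a t ≠ 1 := by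
  refine ⟨CircleInvertible.isUnit_and_ne, fun ⟨hu, hn⟩ => ?_⟩
  have hcirc : circ φ 0 t = t := by
    have h0 : toeplitz φ 0 = 0 := ratD_ext fun w _ hw => by
      rw [toeplitz_val φ 0 w hw, ratEval_zero]
      simp [projPlus, pairing, ratEval_zero]
    simp [circ, times, h0]
  have hA : ConditionA φ t 0 := fun w hw => by
    rw [analyticOrderAt_one_sub_gammaPlus_circ 0 hu hw, hcirc]
  have hB : ConditionB φ t 0 := fun w hw => by
    rw [min_analyticOrderAt_gammaMinus_circ 0 hn hw, hcirc]
  obtain ⟨t', ht', -⟩ := exists_circ_eq hA hB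
  exact ⟨t', ht'⟩

end HardyCircle

theorem corollary3 (φ : HardyCircle.Hardy) :
    (∀ t : HardyCircle.RatD,
      HardyCircle.CircleInvertible φ t ↔
        IsUnit (1 - HardyCircle.gammaPlus φ t) ∧
          ∀ a : ℂ, ‖a‖ < 1 → HardyCircle.hardyEval φ a = 0 → HardyCircle.GammaMinus φ a t ≠ 1) ∧
    (∀ r s : HardyCircle.RatD,
      (∃ t : HardyCircle.RatD, HardyCircle.CircleInvertible φ t ∧ HardyCircle.circ φ r t = s) ↔
        HardyCircle.ConditionA φ r s ∧ HardyCircle.ConditionB φ r s) := by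
  refine ⟨fun t => HardyCircle.circleInvertible_iff, fun r s => ⟨?_, ?_⟩⟩
  · rintro ⟨t, ht, rfl⟩
    obtain ⟨hu, hn⟩ := ht.isUnit_and_ne
    exact ⟨fun w hw => HardyCircle.analyticOrderAt_one_sub_gammaPlus_circ r hu hw,
      fun w hw => HardyCircle.min_analyticOrderAt_gammaMinus_circ r hn hw⟩
  · rintro ⟨hA, hB⟩
    obtain ⟨t, ht, h⟩ := HardyCircle.exists_circ_eq hA hB
    exact ⟨t, HardyCircle.circleInvertible_iff.mpr h, ht⟩
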